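/- Let $\mathbb K$ be an algebraically closed field, $I$ a finite set, $A$ a free $\mathbb Z$-module with basis $\Pi=(\alpha_i)_{i\in I}$, and $\chi:A\times A\to\mathbb K^\times$ a bi-homomorphism (no further assumption on $\chi$ is made). Let $\tilde U=\tilde U(\chi,\Pi)$ be the unital associative $\mathbb K$-algebra with generators $K_\lambda,L_\lambda$ ($\lambda\in A$), $E_i,F_i$ ($i\in I$) and relations $$K_0=L_0=1,\quad K_\lambda K_\mu=K_{\lambda+\mu},\quad L_\lambda L_\mu=L_{\lambda+\mu},\quad K_\lambda L_\mu=L_\mu K_\lambda,$$ $$K_\lambda E_i=\chi(\lambda,\alpha_i)E_iK_\lambda,\quad L_\lambda E_i=\chi(-\alpha_i,\lambda)E_iL_\lambda,\quad K_\lambda F_i=\chi(\lambda,-\alpha_i)F_iK_\lambda,\quad L_\lambda F_i=\chi(\alpha_i,\lambda)F_iL_\lambda,$$ $$E_iF_j-F_jE_i=\delta_{ij}(-K_{\alpha_i}+L_{\alpha_i}).$$ Let $\tilde U^+$ and $\tilde U^-$ be the subalgebras generated by the $E_i$ and by the $F_i$ respectively (they are free on these generators), and let $\tilde B^+$ and $\tilde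 B^-$ be the subalgebras generated by the $E_i$ and $K_\lambda$, and by the $F_i$ and $L_\lambda$. With the coproduct $\Delta(K_\lambda)=K_\lambda\otimes K_\lambda$, $\Delta(L_\lambda)=L_\lambda\otimes L_\lambda$, $\Delta(E_i)=E_i\otimes1+K_{\alpha_i}\otimes E_i$, $\Delta(F_i)=F_i\otimes L_{\alpha_i}+1\otimes F_i$ and the counit $\varepsilon(K_\lambda)=\varepsilon(L_\lambda)=1$, $\varepsilon(E_i)=\varepsilon(F_i)=0$, let $\vartheta:\tilde B^+\times\tilde B^-\to\mathbb K$ be the Drinfeld pairing, i.e. the bilinear form with $\vartheta(K_\lambda,L_\mu)=\chi(\lambda,\mu)$, $\vartheta(E_i,F_j)=\delta_{ij}$, $\vartheta(K_\lambda,F_j)=\vartheta(E_i,L_\lambda)=0$, $\vartheta(X,1)=\varepsilon(X)$, $\vartheta(1,Y)=\varepsilon(Y)$, $\vartheta(XX',Y)=\sum\vartheta(X,Y_{(2)})\vartheta(X',Y_{(1)})$ and $\vartheta(X,YY')=\sum\vartheta(X_{(1)},Y)\vartheta(X_{(2)},Y')$. Let $\tilde I^+\subset\tilde U^+$ and $\tilde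 I^-\subset\tilde U^-$ be the left and right radicals of $\vartheta|_{\tilde U^+\times\tilde U^-}$. The generalized quantum group $U=U(\chi,\Pi)$ is the quotient of $\tilde U$ by the two-sided ideal generated by $\tilde I^+\cup\tilde I^-$; the images of the generators are denoted by the same letters. Let $U^0\subset U$ be the subalgebra generated by all $K_\lambda,L_\lambda$, and for $\beta\in A$ let $U_\beta$ be the span of the products of generators of total degree $\beta$, where $\deg K_\lambda=\deg L_\lambda=0$, $\deg E_i=\alpha_i$, $\deg F_i=-\alpha_i$. For a homomorphism $\varpi:A\to\mathbb K^\times$ let $$Z_\varpi=\{Z\in U_0\mid ZX=\varpi(\beta)XZ\ \text{ for all }\beta\in A,\ X\in U_\beta\}$$ be the $\varpi$-skew graded center of $U$. Lemma. There is exactly one $\mathbb K$-linear map $\mathrm{Sh}:U\to U^0$ (the Shapovalov map) with $\mathrm{Sh}|_{U^0}=\mathrm{id}$ and $\mathrm{Sh}(UE_i)=\mathrm{Sh}(F_iU)=0$ for all $i\in I$, and its restriction $\mathrm{Sh}|_{Z_\varpi}:Z_\varpi\to U^0$ (the $\varpi$-Harish-Chandra map) is injective. -/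

import Mathlib

open scoped TensorProduct

noncomputable section

namespace GenQuantumGroup

universe u v w

variable {K : Type u} {A : Type v} {I : Type w} [Field K] [AddCommGroup A]

/-! ### Bi-homomorphisms -/

/-- The value `χ(a, b)`, as an element of the field `K`, of a bi-homomorphism
`χ : A × A → Kˣ` (the group `Kˣ` is written additively as `Additive Kˣ`). -/
def bichar (χ : A →+ A →+ Additive Kˣ) (a b : A) : K := ((χ a b).toMul : Kˣ)

/-- The value `ϖ(a)`, as an element of `K`, of a homomorphism `ϖ : A → Kˣ`. -/
def char (ϖ : A →+ Additive Kˣ) (a : A) : K := ((ϖ a).toMul : Kˣ)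

section bichar

variable (χ : A →+ A →+ Additive Kˣ)

theorem bichar_add_right (a b c : A) :
    bichar χ a (b + c) = bichar χ a b * bichar χ a c := by
  simp [bichar]

theorem bichar_add_left (a b c : A) :
    bichar χ (a + b) c = bichar χ a c * bichar χ b c := by
  simp [bichar]

theorem bichar_zero_right (a : A) : bichar χ a 0 = 1 := by simp [bichar]

theorem bichar_zero_left (a : A) : bichar χ 0 a = 1 := by simp [bichar]

end bichar

/-! ### The Borel parts `B̃⁺`, `B̃⁻` and the Drinfeld pairing -/

/-- Generators of a Borel part: `tor a` stands for `K_a` in `B̃⁺` and for `L_a` in `B̃⁻`,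
and `root i` stands for `E_i` in `B̃⁺` and for `F_i` in `B̃⁻`. -/
inductive BorelGen (A : Type v) (I : Type w) : Type (max v w)
  | tor (a : A)
  | root (i : I)

/-- The relations of a Borel part with `tor a * root i = c a i • (root i * tor a)`. -/
inductive BorelRel (c : A → I → K) :
    FreeAlgebra K (BorelGen A I) → FreeAlgebra K (BorelGen A I) → Prop
  | tor_zero : BorelRel c (FreeAlgebra.ι K (.tor 0)) 1
  | tor_add (a b : A) :
      BorelRel c (FreeAlgebra.ι K (.tor a) * FreeAlgebra.ι K (.tor b))
        (FreeAlgebra.ι K (.tor (a + b)))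
  | tor_root (a : A) (i : I) :
      BorelRel c (FreeAlgebra.ι K (.tor a) * FreeAlgebra.ι K (.root i))
        (c a i • (FreeAlgebra.ι K (.root i) * FreeAlgebra.ι K (.tor a)))

/-- The algebra `B̃⁺` generated by the `K_λ` and the `E_i`, with `K_λ E_i = χ(λ, α_i) E_i K_λ`. -/
def BorelPos (χ : A →+ A →+ Additive Kˣ) (α : Module.Basis I ℤ A) : Type (max u v w) :=
  RingQuot (BorelRel (I := I) fun a i => bichar χ a (α i))

/-- The algebra `B̃⁻` generated by the `L_λ` and the `F_i`, with `L_λ F_i = χ(α_i, λ) F_i L_λ`. -/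
def BorelNeg (χ : A →+ A →+ Additive Kˣ) (α : Module.Basis I ℤ A) : Type (max u v w) :=
  RingQuot (BorelRel (I := I) fun a i => bichar χ (α i) a)

section Borel

variable (χ : A →+ A →+ Additive Kˣ) (α : Module.Basis I ℤ A)

instance : Ring (BorelPos χ α) := inferInstanceAs (Ring (RingQuot _))
instance : Algebra K (BorelPos χ α) := inferInstanceAs (Algebra K (RingQuot _))
instance : Ring (BorelNeg χ α) := inferInstanceAs (Ring (RingQuot _))
instance : Algebra K (BorelNeg χ α) := inferInstanceAs (Algebra K (RingQuot _))

/-- The generators of `B̃⁺`. -/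
def BorelPos.gen (g : BorelGen A I) : BorelPos χ α :=
  RingQuot.mkAlgHom K (BorelRel (I := I) fun a i => bichar χ a (α i)) (FreeAlgebra.ι K g)

/-- The generators of `B̃⁻`. -/
def BorelNeg.gen (g : BorelGen A I) : BorelNeg χ α :=
  RingQuot.mkAlgHom K (BorelRel (I := I) fun a i => bichar χ (α i) a) (FreeAlgebra.ι K g)

/-- Algebra homomorphisms out of `B̃⁺` from elements satisfying the relations. -/
def BorelPos.lift {R : Type*} [Ring R] [Algebra K R] (f : BorelGen A I → R)
    (h0 : f (.tor 0) = 1) (hadd : ∀ a b, f (.tor a) * f (.tor b) = f (.tor (a + b)))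
    (hroot : ∀ a i, f (.tor a) * f (.root i) = bichar χ a (α i) • (f (.root i) * f (.tor a))) :
    BorelPos χ α →ₐ[K] R :=
  RingQuot.liftAlgHom K ⟨FreeAlgebra.lift K f, by
    rintro _ _ (_ | ⟨a, b⟩ | ⟨a, i⟩)
    · simpa using h0
    · simpa using hadd a b
    · simpa using hroot a i⟩

/-- Algebra homomorphisms out of `B̃⁻` from elements satisfying the relations. -/
def BorelNeg.lift {R : Type*} [Ring R] [Algebra K R] (f : BorelGen A I → R)
    (h0 : f (.tor 0) = 1) (hadd : ∀ a b, f (.tor a) * f (.tor b) = f (.tor (a + b)))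
    (hroot : ∀ a i, f (.tor a) * f (.root i) = bichar χ (α i) a • (f (.root i) * f (.tor a))) :
    BorelNeg χ α →ₐ[K] R :=
  RingQuot.liftAlgHom K ⟨FreeAlgebra.lift K f, by
    rintro _ _ (_ | ⟨a, b⟩ | ⟨a, i⟩)
    · simpa using h0
    · simpa using hadd a b
    · simpa using hroot a i⟩

@[simp] theorem BorelPos.lift_gen {R : Type*} [Ring R] [Algebra K R] (f : BorelGen A I → R)
    (h0 hadd hroot) (g : BorelGen A I) :
    BorelPos.lift χ α f h0 hadd hroot (BorelPos.gen χ α g) = f g := by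
  refine (RingQuot.liftAlgHom_mkAlgHom_apply K _ _ _).trans ?_
  simp

@[simp] theorem BorelNeg.lift_gen {R : Type*} [Ring R] [Algebra K R] (f : BorelGen A I → R)
    (h0 hadd hroot) (g : BorelGen A I) :
    BorelNeg.lift χ α f h0 hadd hroot (BorelNeg.gen χ α g) = f g := by
  refine (RingQuot.liftAlgHom_mkAlgHom_apply K _ _ _).trans ?_
  simp

theorem BorelNeg.algHom_ext {R : Type*} [Semiring R] [Algebra K R] {f g : BorelNeg χ α →ₐ[K] R}
    (h : ∀ x, f (BorelNeg.gen χ α x) = g (BorelNeg.gen χ α x)) : f = g := by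
  refine RingQuot.ringQuot_ext' K _ _ ?_
  refine FreeAlgebra.hom_ext ?_
  funext x
  exact h x

theorem BorelNeg.gen_tor_zero : BorelNeg.gen χ α (.tor 0) = 1 :=
  (RingQuot.mkAlgHom_rel K (BorelRel.tor_zero)).trans (map_one _)

theorem BorelNeg.gen_tor_add (a b : A) :
    BorelNeg.gen χ α (.tor a) * BorelNeg.gen χ α (.tor b) = BorelNeg.gen χ α (.tor (a + b)) :=
  (map_mul _ _ _).symm.trans (RingQuot.mkAlgHom_rel K (BorelRel.tor_add a b))

theorem BorelNeg.gen_tor_root (a : A) (i : I) :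
    BorelNeg.gen χ α (.tor a) * BorelNeg.gen χ α (.root i) =
      bichar χ (α i) a • (BorelNeg.gen χ α (.root i) * BorelNeg.gen χ α (.tor a)) :=
  (map_mul _ _ _).symm.trans ((RingQuot.mkAlgHom_rel K (BorelRel.tor_root a i)).trans
    ((map_smul _ _ _).trans (congrArg _ (map_mul _ _ _))))

/-- The coproduct of `B̃⁻`: `Δ(L_λ) = L_λ ⊗ L_λ`, `Δ(F_i) = F_i ⊗ L_{α_i} + 1 ⊗ F_i`. -/
def BorelNeg.comul : BorelNeg χ α →ₐ[K] BorelNeg χ α ⊗[K] BorelNeg χ α :=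
  BorelNeg.lift χ α
    (fun
      | .tor a => BorelNeg.gen χ α (.tor a) ⊗ₜ BorelNeg.gen χ α (.tor a)
      | .root i => BorelNeg.gen χ α (.root i) ⊗ₜ BorelNeg.gen χ α (.tor (α i)) +
          1 ⊗ₜ BorelNeg.gen χ α (.root i))
    (by simp [BorelNeg.gen_tor_zero, Algebra.TensorProduct.one_def])
    (fun a b => by simp [BorelNeg.gen_tor_add])
    (fun a i => by
      simp only [mul_add, add_mul, Algebra.TensorProduct.tmul_mul_tmul, BorelNeg.gen_tor_add,
        BorelNeg.gen_tor_root, mul_one, one_mul, smul_add, TensorProduct.smul_tmul',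
        TensorProduct.tmul_smul, add_comm a])

/-- The counit of `B̃⁻`: `ε(L_λ) = 1`, `ε(F_i) = 0`. -/
def BorelNeg.counit : BorelNeg χ α →ₐ[K] K :=
  BorelNeg.lift χ α
    (fun
      | .tor _ => 1
      | .root _ => 0)
    rfl (fun _ _ => by simp) (fun _ _ => by simp)

instance : Bialgebra K (BorelNeg χ α) :=
  Bialgebra.ofAlgHom (BorelNeg.comul χ α) (BorelNeg.counit χ α)
    (by
      refine BorelNeg.algHom_ext χ α ?_
      rintro (a | i) <;>
        simp [BorelNeg.comul, TensorProduct.add_tmul, TensorProduct.tmul_add,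
          Algebra.TensorProduct.one_def, add_assoc])
    (by
      refine BorelNeg.algHom_ext χ α ?_
      rintro (a | i) <;> simp [BorelNeg.comul, BorelNeg.counit])
    (by
      refine BorelNeg.algHom_ext χ α ?_
      rintro (a | i) <;> simp [BorelNeg.comul, BorelNeg.counit])

/-- The functional `ϑ(K_λ, ·)` on `B̃⁻`: the algebra homomorphism with
`ϑ(K_λ, L_μ) = χ(λ, μ)` and `ϑ(K_λ, F_j) = 0`. -/
def pairK (a : A) : BorelNeg χ α →ₐ[K] K :=
  BorelNeg.lift χ α
    (fun
      | .tor b => bichar χ a b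
      | .root _ => 0)
    (bichar_zero_right χ a) (fun b c => (bichar_add_right χ a b c).symm) (fun _ _ => by simp)

/-- The algebra homomorphism `Y ↦ !![ϑ(K_{α_i}, Y), ϑ(E_i, Y); 0, ϑ(1, Y)]`; its multiplicativity
encodes the rule `ϑ(E_i, Y Y') = ϑ(E_i, Y) ϑ(1, Y') + ϑ(K_{α_i}, Y) ϑ(E_i, Y')` that comes from
`Δ(E_i) = E_i ⊗ 1 + K_{α_i} ⊗ E_i`. -/
def pairEMatrix [DecidableEq I] (i : I) : BorelNeg χ α →ₐ[K] Matrix (Fin 2) (Fin 2) K :=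
  BorelNeg.lift χ α
    (fun
      | .tor b => !![bichar χ (α i) b, 0; 0, 1]
      | .root j => !![0, if i = j then 1 else 0; 0, 0])
    (by simp [bichar_zero_right, Matrix.one_fin_two])
    (fun b c => by simp [bichar_add_right])
    (fun b j => by
      by_cases h : i = j
      · subst h; simp
      · simp [h])

/-- The functional `ϑ(E_i, ·)` on `B̃⁻`, with `ϑ(E_i, F_j) = δ_{ij}` and `ϑ(E_i, L_μ) = 0`. -/
def pairE [DecidableEq I] (i : I) : BorelNeg χ α →ₗ[K] K :=
  Matrix.entryLinearMap K K 0 1 ∘ₗ (pairEMatrix χ α i).toLinearMap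

@[simp] theorem BorelNeg.comul_gen_tor (a : A) :
    BorelNeg.comul χ α (BorelNeg.gen χ α (.tor a)) =
      BorelNeg.gen χ α (.tor a) ⊗ₜ BorelNeg.gen χ α (.tor a) := by
  simp [BorelNeg.comul]

@[simp] theorem BorelNeg.comul_gen_root (i : I) :
    BorelNeg.comul χ α (BorelNeg.gen χ α (.root i)) =
      BorelNeg.gen χ α (.root i) ⊗ₜ BorelNeg.gen χ α (.tor (α i)) +
        1 ⊗ₜ BorelNeg.gen χ α (.root i) := by
  simp [BorelNeg.comul]

theorem pairK_zero : pairK χ α 0 = BorelNeg.counit χ α := by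
  refine BorelNeg.algHom_ext χ α ?_
  rintro (b | j) <;> simp [pairK, BorelNeg.counit, bichar_zero_left]

theorem pairK_mul (a b : A) :
    WithConv.toConv (pairK χ α b).toLinearMap * WithConv.toConv (pairK χ α a).toLinearMap =
      WithConv.toConv (pairK χ α (a + b)).toLinearMap := by
  have h : (Algebra.TensorProduct.lift (pairK χ α b) (pairK χ α a)
      (fun _ _ => Commute.all _ _)).comp (BorelNeg.comul χ α) = pairK χ α (a + b) := by
    refine BorelNeg.algHom_ext χ α ?_
    rintro (c | j) <;> simp [pairK, bichar_add_left, mul_comm]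
  ext z
  have hz := DFunLike.congr_fun h z
  refine Eq.trans ?_ hz
  change LinearMap.mul' K K (TensorProduct.map _ _ (BorelNeg.comul χ α z)) =
    Algebra.TensorProduct.lift (pairK χ α b) (pairK χ α a) (fun _ _ => Commute.all _ _)
      (BorelNeg.comul χ α z)
  generalize BorelNeg.comul χ α z = t
  induction t with
  | zero => simp
  | tmul x y => simp
  | add x y hx hy => simp only [map_add, hx, hy]

theorem pairK_pairE [DecidableEq I] (a : A) (i : I) :
    WithConv.toConv (pairE χ α i) * WithConv.toConv (pairK χ α a).toLinearMap =
      bichar χ a (α i) •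
        (WithConv.toConv (pairK χ α a).toLinearMap * WithConv.toConv (pairE χ α i)) := by
  let κ : BorelNeg χ α →ₐ[K] Matrix (Fin 2) (Fin 2) K :=
    (Algebra.ofId K (Matrix (Fin 2) (Fin 2) K)).comp (pairK χ α a)
  let D : Matrix (Fin 2) (Fin 2) K := !![bichar χ a (α i), 0; 0, 1]
  have hκ : ∀ x (M : Matrix (Fin 2) (Fin 2) K), Commute (κ x) M := fun x M =>
    Algebra.commutes (pairK χ α a x) M
  have hκ' : ∀ x, κ x = pairK χ α a x • (1 : Matrix (Fin 2) (Fin 2) K) := fun x =>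
    Algebra.algebraMap_eq_smul_one (A := Matrix (Fin 2) (Fin 2) K) (pairK χ α a x)
  let Φ := (Algebra.TensorProduct.lift (pairEMatrix χ α i) κ
    (fun x y => (hκ y _).symm)).comp (BorelNeg.comul χ α)
  let Ψ := (Algebra.TensorProduct.lift κ (pairEMatrix χ α i)
    (fun x y => hκ x _)).comp (BorelNeg.comul χ α)
  have key : ∀ z, D * Ψ z = Φ z * D := by
    let S : Subalgebra K (BorelNeg χ α) :=
      { carrier := {z | D * Ψ z = Φ z * D}
        mul_mem' := fun {x y} (hx : _ = _) (hy : _ = _) => by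
          simp only [Set.mem_ofPred_eq, map_mul]
          rw [← mul_assoc, hx, mul_assoc, hy, mul_assoc]
        add_mem' := fun {x y} (hx : _ = _) (hy : _ = _) => by
          simp only [Set.mem_ofPred_eq, map_add, mul_add, add_mul, hx, hy]
        algebraMap_mem' := fun r => by
          simp only [Set.mem_ofPred_eq, AlgHom.commutes]
          exact (Algebra.commutes r D).symm }
    have hS : ∀ x, BorelNeg.gen χ α x ∈ S := by
      rintro (b | j)
      · change D * Ψ _ = Φ _ * D
        simp [D, Φ, Ψ, hκ', pairEMatrix, pairK, mul_comm]
      · change D * Ψ _ = Φ _ * D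
        by_cases h : i = j
        · subst h
          simp [D, Φ, Ψ, hκ', pairEMatrix, pairK]
        · simp [D, Φ, Ψ, hκ', pairEMatrix, pairK, h]
    intro z
    obtain ⟨z, rfl⟩ := RingQuot.mkAlgHom_surjective K _ z
    change _ ∈ S
    induction z using FreeAlgebra.induction with
    | grade0 r => rw [AlgHom.commutes]; exact S.algebraMap_mem r
    | grade1 x => exact hS x
    | mul x y hx hy => rw [map_mul]; exact S.mul_mem hx hy
    | add x y hx hy => rw [map_add]; exact S.add_mem hx hy
  ext z
  have hz := congrFun (congrFun (key z) 0) 1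
  have hL : ∀ t, LinearMap.mul' K K (TensorProduct.map (pairE χ α i) (pairK χ α a).toLinearMap t) =
      (Algebra.TensorProduct.lift (pairEMatrix χ α i) κ (fun x y => (hκ y _).symm) t) 0 1 := by
    intro t
    induction t with
    | zero => simp
    | tmul x y =>
      simp [hκ', pairE, mul_comm]
    | add x y hx hy => simp only [map_add, hx, hy, Matrix.add_apply]
  have hR : ∀ t, LinearMap.mul' K K (TensorProduct.map (pairK χ α a).toLinearMap (pairE χ α i) t) =
      (Algebra.TensorProduct.lift κ (pairEMatrix χ α i) (fun x y => hκ x _) t) 0 1 := by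
    intro t
    induction t with
    | zero => simp
    | tmul x y =>
      simp [hκ', pairE]
    | add x y hx hy => simp only [map_add, hx, hy, Matrix.add_apply]
  have hz' : bichar χ a (α i) * (Ψ z) 0 1 = (Φ z) 0 1 := by
    simpa [D, Matrix.mul_apply] using hz
  exact (hL _).trans (hz'.symm.trans (congrArg _ (hR _).symm))

/-- The Drinfeld pairing `ϑ : B̃⁺ × B̃⁻ → K`, in the form `X ↦ ϑ(X, ·)`. The rule
`ϑ(X X', Y) = ∑ ϑ(X, Y₍₂₎) ϑ(X', Y₍₁₎)` says that this is an algebra homomorphism into the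
opposite of the convolution algebra of linear functionals on the coalgebra `B̃⁻`. -/
def drinfeldHom [DecidableEq I] :
    BorelPos χ α →ₐ[K] (WithConv (BorelNeg χ α →ₗ[K] K))ᵐᵒᵖ :=
  BorelPos.lift χ α
    (fun
      | .tor a => MulOpposite.op (WithConv.toConv (pairK χ α a).toLinearMap)
      | .root i => MulOpposite.op (WithConv.toConv (pairE χ α i)))
    (by
      simp only [pairK_zero]
      rfl)
    (fun a b => by simp only [← MulOpposite.op_mul, pairK_mul])
    (fun a i => by simp only [← MulOpposite.op_mul, pairK_pairE, MulOpposite.op_smul])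

/-- The value `ϑ(X, Y)` of the Drinfeld pairing. -/
def drinfeldPairing [DecidableEq I] (X : BorelPos χ α) (Y : BorelNeg χ α) : K :=
  (drinfeldHom χ α X).unop Y

/-- The inclusion of `Ũ⁺`, the free algebra on the `E_i`, into `B̃⁺`. -/
def BorelPos.ofRoot : FreeAlgebra K I →ₐ[K] BorelPos χ α :=
  FreeAlgebra.lift K fun i => BorelPos.gen χ α (.root i)

/-- The inclusion of `Ũ⁻`, the free algebra on the `F_i`, into `B̃⁻`. -/
def BorelNeg.ofRoot : FreeAlgebra K I →ₐ[K] BorelNeg χ α :=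
  FreeAlgebra.lift K fun i => BorelNeg.gen χ α (.root i)

/-- The radical `Ĩ⁺ = {X ∈ Ũ⁺ | ϑ(X, Y) = 0 for all Y ∈ Ũ⁻}`. -/
def radPos [DecidableEq I] : Set (FreeAlgebra K I) :=
  {X | ∀ Y : FreeAlgebra K I,
    drinfeldPairing χ α (BorelPos.ofRoot χ α X) (BorelNeg.ofRoot χ α Y) = 0}

/-- The radical `Ĩ⁻ = {Y ∈ Ũ⁻ | ϑ(X, Y) = 0 for all X ∈ Ũ⁺}`. -/
def radNeg [DecidableEq I] : Set (FreeAlgebra K I) :=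
  {Y | ∀ X : FreeAlgebra K I,
    drinfeldPairing χ α (BorelPos.ofRoot χ α X) (BorelNeg.ofRoot χ α Y) = 0}

end Borel

/-! ### The algebra `Ũ(χ, Π)` given by generators and relations -/

variable [DecidableEq I]

/-- The generators `K_λ`, `L_λ` (`λ ∈ A`), `E_i`, `F_i` (`i ∈ I`). -/
inductive Gen (A : Type v) (I : Type w) : Type (max v w)
  | K (a : A)
  | L (a : A)
  | E (i : I)
  | F (i : I)

/-- The free generator attached to `g`. -/
abbrev Gen.free (K : Type u) [Field K] (g : Gen A I) : FreeAlgebra K (Gen A I) :=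
  FreeAlgebra.ι K g

open Gen in
/-- The defining relations of `Ũ(χ, Π)`, where `Π = (α_i)` is the basis `α`. -/
inductive TildeRel (χ : A →+ A →+ Additive Kˣ) (α : Module.Basis I ℤ A) :
    FreeAlgebra K (Gen A I) → FreeAlgebra K (Gen A I) → Prop
  | K_zero : TildeRel χ α ((Gen.K 0).free K) 1
  | L_zero : TildeRel χ α ((Gen.L 0).free K) 1
  | K_add (a b : A) :
      TildeRel χ α ((Gen.K a).free K * (Gen.K b).free K) ((Gen.K (a + b)).free K)
  | L_add (a b : A) :
      TildeRel χ α ((Gen.L a).free K * (Gen.L b).free K) ((Gen.L (a + b)).free K)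
  | K_L (a b : A) :
      TildeRel χ α ((Gen.K a).free K * (Gen.L b).free K) ((Gen.L b).free K * (Gen.K a).free K)
  | K_E (a : A) (i : I) :
      TildeRel χ α ((Gen.K a).free K * (Gen.E i).free K)
        (bichar χ a (α i) • ((Gen.E i).free K * (Gen.K a).free K))
  | L_E (a : A) (i : I) :
      TildeRel χ α ((Gen.L a).free K * (Gen.E i).free K)
        (bichar χ (-α i) a • ((Gen.E i).free K * (Gen.L a).free K))
  | K_F (a : A) (i : I) :
      TildeRel χ α ((Gen.K a).free K * (Gen.F i).free K)
        (bichar χ a (-α i) • ((Gen.F i).free K * (Gen.K a).free K))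
  | L_F (a : A) (i : I) :
      TildeRel χ α ((Gen.L a).free K * (Gen.F i).free K)
        (bichar χ (α i) a • ((Gen.F i).free K * (Gen.L a).free K))
  | E_F (i j : I) :
      TildeRel χ α ((Gen.E i).free K * (Gen.F j).free K - (Gen.F j).free K * (Gen.E i).free K)
        (if i = j then - (Gen.K (α i)).free K + (Gen.L (α i)).free K else 0)

/-- The algebra `Ũ(χ, Π)`. -/
abbrev Tilde (χ : A →+ A →+ Additive Kˣ) (α : Module.Basis I ℤ A) : Type (max u v w) :=
  RingQuot (TildeRel χ α)

/-- The generators of `Ũ(χ, Π)`. -/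
def Tilde.gen (χ : A →+ A →+ Additive Kˣ) (α : Module.Basis I ℤ A) (g : Gen A I) : Tilde χ α :=
  RingQuot.mkAlgHom K (TildeRel χ α) (g.free K)

/-- The inclusion of `Ũ⁺`, the free algebra on the `E_i`, into `Ũ(χ, Π)`. -/
def Tilde.ofPos (χ : A →+ A →+ Additive Kˣ) (α : Module.Basis I ℤ A) :
    FreeAlgebra K I →ₐ[K] Tilde χ α :=
  FreeAlgebra.lift K fun i => Tilde.gen χ α (.E i)

/-- The inclusion of `Ũ⁻`, the free algebra on the `F_i`, into `Ũ(χ, Π)`. -/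
def Tilde.ofNeg (χ : A →+ A →+ Additive Kˣ) (α : Module.Basis I ℤ A) :
    FreeAlgebra K I →ₐ[K] Tilde χ α :=
  FreeAlgebra.lift K fun i => Tilde.gen χ α (.F i)

/-! ### The generalized quantum group `U(χ, Π)` -/

/-- The relations `X = 0` in `Ũ(χ, Π)` for `X` in `Ĩ⁺` or in `Ĩ⁻`. -/
inductive URel (χ : A →+ A →+ Additive Kˣ) (α : Module.Basis I ℤ A) :
    Tilde χ α → Tilde χ α → Prop
  | pos (X : FreeAlgebra K I) (hX : X ∈ radPos χ α) : URel χ α (Tilde.ofPos χ α X) 0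
  | neg (Y : FreeAlgebra K I) (hY : Y ∈ radNeg χ α) : URel χ α (Tilde.ofNeg χ α Y) 0

/-- The generalized quantum group `U(χ, Π)`: the quotient of `Ũ(χ, Π)` by the two-sided ideal
generated by `Ĩ⁺` and `Ĩ⁻`. -/
abbrev U (χ : A →+ A →+ Additive Kˣ) (α : Module.Basis I ℤ A) : Type (max u v w) :=
  RingQuot (URel χ α)

section U

variable (χ : A →+ A →+ Additive Kˣ) (α : Module.Basis I ℤ A)

/-- The generators `K_λ`, `L_λ`, `E_i`, `F_i` of `U(χ, Π)`. -/
def U.gen (g : Gen A I) : U χ α := RingQuot.mkAlgHom K (URel χ α) (Tilde.gen χ α g)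

/-- The subalgebra `U⁰` generated by the `K_λ` and the `L_λ`. -/
def U0 : Subalgebra K (U χ α) :=
  Algebra.adjoin K (Set.range (fun a => U.gen χ α (.K a)) ∪ Set.range fun a => U.gen χ α (.L a))

/-- The degree in `A` of a generator: `0` for `K_λ`, `L_λ`, `α_i` for `E_i`, `-α_i` for `F_i`. -/
def Gen.deg : Gen A I → A
  | .K _ => 0
  | .L _ => 0
  | .E i => α i
  | .F i => - α i

/-- The homogeneous component `U_β`, spanned by the products of generators of total degree `β`. -/
def gradedPiece (β : A) : Submodule K (U χ α) :=
  Submodule.span K {x | ∃ l : List (Gen A I),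
    (l.map (Gen.deg α)).sum = β ∧ (l.map (U.gen χ α)).prod = x}

/-- The `ϖ`-skew graded center
`Z_ϖ = {Z ∈ U_0 | Z X = ϖ(β) X Z for all β ∈ A and X ∈ U_β}`. -/
def skewCenter (ϖ : A →+ Additive Kˣ) : Submodule K (U χ α) where
  carrier := {Z | Z ∈ gradedPiece χ α 0 ∧
    ∀ β : A, ∀ X ∈ gradedPiece χ α β, Z * X = char ϖ β • (X * Z)}
  add_mem' := fun ⟨h0, h⟩ ⟨h0', h'⟩ => ⟨add_mem h0 h0', fun β X hX => by
    rw [add_mul, mul_add, h β X hX, h' β X hX, smul_add]⟩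
  zero_mem' := ⟨zero_mem _, fun β X _ => by simp⟩
  smul_mem' := fun c Z ⟨h0, h⟩ => ⟨Submodule.smul_mem _ c h0, fun β X hX => by
    rw [smul_mul_assoc, mul_smul_comm, h β X hX, smul_comm]⟩

/-- The defining properties of the Shapovalov map: `Sh` restricts to the identity on `U⁰` and
vanishes on every `U E_i` and every `F_i U`. -/
structure IsShapovalovMap (Sh : U χ α →ₗ[K] U0 χ α) : Prop where
  map_U0 (Z : U0 χ α) : Sh Z = Z
  map_mul_E (X : U χ α) (i : I) : Sh (X * U.gen χ α (.E i)) = 0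
  map_F_mul (X : U χ α) (i : I) : Sh (U.gen χ α (.F i) * X) = 0

end U

end GenQuantumGroup

end

noncomputable section

namespace GenQuantumGroup

universe u v w

variable {K : Type u} {A : Type v} {I : Type w} [Field K] [AddCommGroup A]

section Words

/-! ### Operators on the free algebra -/

/-! ### Values of characters and of the bi-homomorphism -/

section char

/-! The argument lives on the universal Verma module, `U⁻` tensored with the group algebra of `A ×
A` (the exponents of `K_a L_b`). An element of `U` acts there as a Laurent polynomial in the torus
whose coefficients are operators on `U⁻`: `F_i` multiplies, `K_a` and `L_a` rescale weights, and
`E_i` is `L_{α_i} ∂ - K_{α_i} ∂'` for two skew derivations of `U⁻` (`genAct`, `rep`).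

The Shapovalov map is the vacuum expectation: apply `u` to `1` and take constant terms in `U⁻`. It
has the required properties because each `E_i` kills `1` and the constant term kills every multiple
of `F_i`. It is unique because the monomials `F_l K_a L_b E_m` span `U` (`U.triangular_eq_top`).

For injectivity, let `Z` be skew central with `Sh(Z) = 0`. Since `Z` has degree zero, `Z · 1` has
only scalar coefficients, namely those of `Sh(Z)`, so `Z · 1 = 0`. Skew centrality gives `Z F_l · 1
= ϖ(deg F_l) F_l Z · 1 = 0` for every word `l`, so `Z` acts by zero. Hence everything rests on
faithfulness of the module (`rep_injective`).

Two facts about the Drinfeld pairing carry this. First, on `Ũ⁺ × Ũ⁻` it is the constant term of an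
action by skew derivations (`drinfeldPairing_ofRoot`); multiplications and skew derivations are
adjoint to each other, so they preserve the radicals and the action descends to `U`. Second, when a
word in `E` of length `n` acts, torus exponents whose `L`-part has height `n` arise only from
choosing the `L`-term of every letter, and the resulting coefficient is the pairing
(`coeff_rep_word_of_le`, `const_act_of_le`). In a combination of triangular products acting by zero,
comparing these top coefficients by induction on word length forces every `Ũ⁺`-factor into the
radical (`constTerm_dualOp_of_rep_eq_zero`), where it vanishes in `U`. No nondegeneracy or
genericity of `χ` enters. -/

theorem char_add_right (θ : A →+ Additive Kˣ) (a b : A) :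
    char θ (a + b) = char θ a * char θ b := by
  simp [char]

theorem char_zero_right (θ : A →+ Additive Kˣ) : char θ 0 = 1 := by simp [char]

theorem char_add_left (θ φ : A →+ Additive Kˣ) (a : A) :
    char (θ + φ) a = char θ a * char φ a := by
  simp [char]

theorem char_zero_left (a : A) : char (0 : A →+ Additive Kˣ) a = 1 := by simp [char]

theorem char_neg_mul_char (θ : A →+ Additive Kˣ) (a : A) : char (-θ) a * char θ a = 1 := by
  simp [char]

theorem char_flip (χ : A →+ A →+ Additive Kˣ) (a b : A) : char (χ.flip a) b = bichar χ b a := rfl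

theorem char_apply (χ : A →+ A →+ Additive Kˣ) (a b : A) : char (χ a) b = bichar χ a b := rfl

theorem char_neg_apply (χ : A →+ A →+ Additive Kˣ) (a b : A) :
    char (-χ a) b = bichar χ a (-b) := by
  simp [char, bichar]

end char

variable (K) in
/-- The monomial in the free algebra attached to a word. -/
def word (l : List I) : FreeAlgebra K I := (l.map (FreeAlgebra.ι K)).prod

@[simp] theorem word_nil : word K ([] : List I) = 1 := rfl

@[simp] theorem word_cons (i : I) (l : List I) :
    word K (i :: l) = FreeAlgebra.ι K i * word K l := by simp [word]

theorem word_append (l m : List I) : word K (l ++ m) = word K l * word K m := by simp [word]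

variable (K I) in
/-- The basis of the free algebra consisting of the words. -/
def wordBasis : Module.Basis (List I) K (FreeAlgebra K I) := FreeAlgebra.basisFreeMonoid K I

@[simp] theorem wordBasis_apply (l : List I) : wordBasis K I l = word K l := by
  change MonoidAlgebra.lift K (FreeAlgebra K I) (FreeMonoid I) (FreeMonoid.lift (FreeAlgebra.ι K))
    (MonoidAlgebra.single (FreeMonoid.ofList l) 1) = _
  rw [MonoidAlgebra.lift_single, one_smul, FreeMonoid.lift_apply]
  rfl

theorem linearMap_ext_word {M : Type*} [AddCommMonoid M] [Module K M]
    {f g : FreeAlgebra K I →ₗ[K] M} (h : ∀ l, f (word K l) = g (word K l)) : f = g :=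
  (wordBasis K I).ext fun l => by simpa using h l

theorem span_range_word : Submodule.span K (Set.range (word K (I := I))) = ⊤ := by
  rw [← (wordBasis K I).span_eq]
  congr 1
  ext; simp

theorem word_induction {p : FreeAlgebra K I → Prop} (hword : ∀ l, p (word K l))
    (hadd : ∀ X Y, p X → p Y → p (X + Y)) (hsmul : ∀ (c : K) X, p X → p (c • X))
    (X : FreeAlgebra K I) : p X := by
  have hX : X ∈ Submodule.span K (Set.range (word K (I := I))) := by simp [span_range_word]
  induction hX using Submodule.span_induction with
  | mem x hx => obtain ⟨l, rfl⟩ := hx; exact hword l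
  | zero => simpa using hsmul 0 _ (hword [])
  | add x y _ _ hx hy => exact hadd x y hx hy
  | smul c x _ hx => exact hsmul c x hx

/-- The linear map with prescribed values on words. -/
def ofWords {M : Type*} [AddCommMonoid M] [Module K M] (f : List I → M) :
    FreeAlgebra K I →ₗ[K] M := (wordBasis K I).constr K f

@[simp] theorem ofWords_word {M : Type*} [AddCommMonoid M] [Module K M] (f : List I → M)
    (l : List I) : ofWords f (word K l) = f l := by
  rw [← wordBasis_apply, ofWords, Module.Basis.constr_basis]

/-- The constant term. -/
abbrev constTerm : FreeAlgebra K I →ₐ[K] K := FreeAlgebra.algebraMapInv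

@[simp] theorem constTerm_ι (i : I) : constTerm (FreeAlgebra.ι K i) = 0 := by
  simp [FreeAlgebra.algebraMapInv]

/-- Left multiplication by a generator. -/
abbrev lmul (i : I) : Module.End K (FreeAlgebra K I) := LinearMap.mulLeft K (FreeAlgebra.ι K i)

variable (α : Module.Basis I ℤ A)

/-- The weight of a word. -/
def wt (l : List I) : A := (l.map α).sum

@[simp] theorem wt_nil : wt α [] = 0 := rfl

@[simp] theorem wt_cons (i : I) (l : List I) : wt α (i :: l) = α i + wt α l := by simp [wt]

/-- The operator scaling each word by the value of a character at its weight. -/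
def scal (θ : A →+ Additive Kˣ) : Module.End K (FreeAlgebra K I) :=
  ofWords fun l => char θ (wt α l) • word K l

@[simp] theorem scal_word (θ : A →+ Additive Kˣ) (l : List I) :
    scal α θ (word K l) = char θ (wt α l) • word K l := by simp [scal]

@[simp] theorem scal_one (θ : A →+ Additive Kˣ) :
    scal α θ (1 : FreeAlgebra K I) = 1 := by
  simpa [char_zero_right] using scal_word (K := K) α θ []

theorem scal_zero : scal α (0 : A →+ Additive Kˣ) = 1 :=
  linearMap_ext_word fun l => by simp [char_zero_left]

theorem scal_add (θ φ : A →+ Additive Kˣ) : scal α (θ + φ) = scal α θ * scal α φ :=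
  linearMap_ext_word fun l => by simp [char_add_left, smul_smul, mul_comm]

theorem scal_ι_mul (θ : A →+ Additive Kˣ) (i : I) (Y : FreeAlgebra K I) :
    scal α θ (FreeAlgebra.ι K i * Y) = char θ (α i) • (FreeAlgebra.ι K i * scal α θ Y) := by
  have : scal α θ * lmul i = char θ (α i) • (lmul i * scal α θ) := by
    refine linearMap_ext_word fun l => ?_
    have := scal_word α θ (i :: l)
    simpa [char_add_right, smul_smul] using this
  simpa using congr($this Y)

theorem constTerm_scal (θ : A →+ Additive Kˣ) (Y : FreeAlgebra K I) :
    constTerm (scal α θ Y) = constTerm Y := by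
  have : constTerm.toLinearMap ∘ₗ scal α θ = constTerm.toLinearMap := by
    refine linearMap_ext_word fun l => ?_
    cases l <;> simp [scal_ι_mul]
  simpa using congr($this Y)

/-- Right multiplication by a generator after scaling by a character. -/
def rmul (θ : A →+ Additive Kˣ) (j : I) : Module.End K (FreeAlgebra K I) :=
  LinearMap.mulRight K (FreeAlgebra.ι K j) ∘ₗ scal α θ

theorem rmul_ι_mul (θ : A →+ Additive Kˣ) (i j : I) (Y : FreeAlgebra K I) :
    rmul α θ j (FreeAlgebra.ι K i * Y) = char θ (α i) • (FreeAlgebra.ι K i * rmul α θ j Y) := by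
  simp [rmul, scal_ι_mul, mul_assoc]

theorem constTerm_rmul (θ : A →+ Additive Kˣ) (j : I) (Y : FreeAlgebra K I) :
    constTerm (rmul α θ j Y) = 0 := by
  simp [rmul]

theorem scal_mul_ι (θ : A →+ Additive Kˣ) (j : I) (Y : FreeAlgebra K I) :
    scal α θ (Y * FreeAlgebra.ι K j) = char θ (α j) • (scal α θ Y * FreeAlgebra.ι K j) := by
  have : scal α θ ∘ₗ LinearMap.mulRight K (FreeAlgebra.ι K j) =
      char θ (α j) • (LinearMap.mulRight K (FreeAlgebra.ι K j) ∘ₗ scal α θ) := by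
    refine linearMap_ext_word fun l => ?_
    have := scal_word α θ (l ++ [j])
    simpa [word_append, wt, char_add_right, smul_smul, mul_comm] using this
  simpa using congr($this Y)

theorem rmul_scal (θ φ : A →+ Additive Kˣ) (j : I) (Y : FreeAlgebra K I) :
    scal α φ (rmul α θ j Y) = char φ (α j) • rmul α θ j (scal α φ Y) := by
  simp only [rmul, LinearMap.comp_apply, LinearMap.mulRight_apply, scal_mul_ι]
  rw [← Module.End.mul_apply, ← Module.End.mul_apply, ← scal_add, ← scal_add, add_comm φ]

variable [DecidableEq I]

/-- Auxiliary recursion for `skewDer`. -/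
def skewDerAux (θ : A →+ Additive Kˣ) (i : I) : List I → FreeAlgebra K I
  | [] => 0
  | j :: l => (if i = j then char θ (wt α l) • word K l else 0) +
      FreeAlgebra.ι K j * skewDerAux θ i l

/-- The skew derivation with `F_j ↦ δ_{ij}` and `∂(F_j Y) = δ_{ij} θ(Y) + F_j ∂(Y)`. -/
def skewDer (θ : A →+ Additive Kˣ) (i : I) : Module.End K (FreeAlgebra K I) :=
  ofWords (skewDerAux α θ i)

@[simp] theorem skewDer_one (θ : A →+ Additive Kˣ) (i : I) :
    skewDer α θ i (1 : FreeAlgebra K I) = 0 := ofWords_word _ []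

theorem skewDer_ι_mul (θ : A →+ Additive Kˣ) (i j : I) (Y : FreeAlgebra K I) :
    skewDer α θ i (FreeAlgebra.ι K j * Y) =
      (if i = j then scal α θ Y else 0) + FreeAlgebra.ι K j * skewDer α θ i Y := by
  have : skewDer (K := K) α θ i * lmul j =
      (if i = j then scal (K := K) α θ else 0) + lmul j * skewDer (K := K) α θ i := by
    refine linearMap_ext_word fun l => ?_
    have := ofWords_word (K := K) (skewDerAux (K := K) α θ i) (j :: l)
    rw [word_cons] at this
    simp only [Module.End.mul_apply, LinearMap.mulLeft_apply, LinearMap.add_apply]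
    refine this.trans ?_
    rw [skewDerAux, skewDer, ofWords_word]
    congr 1
    split_ifs
    · rw [scal_word]
    · rfl
  have h := congr($this Y)
  split_ifs at h ⊢ <;> simpa using h

theorem skewDer_scal (θ φ : A →+ Additive Kˣ) (i : I) (Y : FreeAlgebra K I) :
    skewDer α φ i (scal α θ Y) = char θ (α i) • scal α θ (skewDer α φ i Y) := by
  have : skewDer α φ i * scal α θ = char θ (α i) • (scal α θ * skewDer (K := K) α φ i) := by
    refine linearMap_ext_word fun l => ?_
    induction l with
    | nil => simp
    | cons j l ih =>
      simp only [Module.End.mul_apply, LinearMap.smul_apply] at ih ⊢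
      rw [word_cons, scal_ι_mul, map_smul, skewDer_ι_mul, skewDer_ι_mul, ih, map_add, scal_ι_mul]
      split_ifs with h
      · subst h
        rw [scal_word, map_smul, scal_word, map_smul, scal_word, smul_add, smul_add]
        congr 1
        · simp only [smul_smul, mul_comm (char φ _)]
        · simp only [mul_smul_comm, smul_smul]
      · simp only [map_zero, zero_add, mul_smul_comm, smul_smul, mul_comm (char θ (α i))]
  simpa using congr($this Y)

/-- Both sides are the coefficient of the one-letter word `F_i` in `Y`; the character only rescales
longer words. This lets the derivation attached to `K_{α_i}` be traded for the one attached to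
`L_{α_i}` under the constant term. -/
theorem constTerm_skewDer (θ φ : A →+ Additive Kˣ) (i : I) (Y : FreeAlgebra K I) :
    constTerm (skewDer α θ i Y) = constTerm (skewDer α φ i Y) := by
  have : constTerm.toLinearMap ∘ₗ skewDer α θ i = constTerm.toLinearMap ∘ₗ skewDer α φ i := by
    refine linearMap_ext_word fun l => ?_
    cases l with
    | nil => simp
    | cons j l =>
      simp only [word_cons, LinearMap.comp_apply, AlgHom.toLinearMap_apply, skewDer_ι_mul]
      rw [map_add, map_add, map_mul, map_mul, constTerm_ι]
      split_ifs <;> simp only [constTerm_scal, zero_mul, map_zero]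
  simpa using congr($this Y)

/-- The hypothesis says that the scalars produced by moving each derivation past the other's scaling
are inverse. It holds for `θ = -χ (α i)` and `φ = χ.flip (α j)`, so every `K`-type derivation
commutes up to a scalar with every `L`-type one. -/
theorem skewDer_skewDer (θ φ : A →+ Additive Kˣ) (i j : I) (h : char φ (α i) * char θ (α j) = 1)
    (Y : FreeAlgebra K I) :
    skewDer α θ i (skewDer α φ j Y) = char φ (α i) • skewDer α φ j (skewDer α θ i Y) := by
  have : skewDer α θ i * skewDer α φ j =
      char φ (α i) • (skewDer (K := K) α φ j * skewDer α θ i) := by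
    refine linearMap_ext_word fun l => ?_
    induction l with
    | nil => simp
    | cons k l ih =>
      simp only [Module.End.mul_apply, LinearMap.smul_apply] at ih ⊢
      have e1 : char φ (α i) • scal α φ (skewDer α θ i (word K l)) =
        skewDer α θ i (scal α φ (word K l)) := (skewDer_scal ..).symm
      have e2 : scal α θ (skewDer α φ j (word K l)) =
          char φ (α i) • skewDer α φ j (scal α θ (word K l)) := by
        rw [skewDer_scal, smul_smul, h, one_smul]
      simp only [word_cons, skewDer_ι_mul, map_add, ih, smul_add, mul_smul_comm]
      have f1 : skewDer α θ i (if j = k then scal α φ (word K l) else 0) =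
          char φ (α i) • if j = k then scal α φ (skewDer α θ i (word K l)) else 0 := by
        split_ifs <;> simp only [e1, map_zero, smul_zero]
      have f2 : (if i = k then scal α θ (skewDer α φ j (word K l)) else 0) =
          char φ (α i) • skewDer α φ j (if i = k then scal α θ (word K l) else 0) := by
        split_ifs <;> simp only [e2, map_zero, smul_zero]
      rw [f1, f2]
      abel
  simpa using congr($this Y)

/-- Auxiliary recursion for `leftDer`. -/
def leftDerAux (θ : A →+ Additive Kˣ) (i : I) : List I → FreeAlgebra K I
  | [] => 0
  | j :: l => (if j = i then word K l else 0) +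
      char θ (α j) • (FreeAlgebra.ι K j * leftDerAux θ i l)

/-- The skew derivation with `E_j ↦ δ_{ij}` and `∂(E_j X) = δ_{ij} X + θ(α_j) E_j ∂(X)`. -/
def leftDer (θ : A →+ Additive Kˣ) (i : I) : Module.End K (FreeAlgebra K I) :=
  ofWords (leftDerAux α θ i)

@[simp] theorem leftDer_one (θ : A →+ Additive Kˣ) (i : I) :
    leftDer α θ i (1 : FreeAlgebra K I) = 0 := ofWords_word _ []

theorem leftDer_ι_mul_word (θ : A →+ Additive Kˣ) (i j : I) (l : List I) :
    leftDer α θ i (FreeAlgebra.ι K j * word K l) =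
      (if j = i then word K l else 0) +
        char θ (α j) • (FreeAlgebra.ι K j * leftDer α θ i (word K l)) := by
  rw [← word_cons, leftDer, ofWords_word, ofWords_word, leftDerAux]

/-- The twist in `rmul` is chosen so that right multiplication has a commutator with the derivations
of the same shape as left multiplication has in `skewDer_ι_mul`, with `θ` as the scaling. Both cases
can then be treated by `dualOp_commutator`. -/
theorem skewDer_rmul (θ φ : A →+ Additive Kˣ) (i j : I) (h : char φ (α j) * char θ (α i) = 1)
    (Y : FreeAlgebra K I) :
    skewDer α φ i (rmul α θ j Y) =
      rmul α θ j (skewDer α φ i Y) + if i = j then scal α θ Y else 0 := by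
  have : skewDer α φ i * rmul α θ j =
      rmul α θ j * skewDer α φ i + if i = j then scal α (K := K) θ else 0 := by
    refine linearMap_ext_word fun l => ?_
    simp only [Module.End.mul_apply, LinearMap.add_apply]
    induction l with
    | nil =>
      have := skewDer_ι_mul (K := K) α φ i j 1
      rw [mul_one] at this
      split_ifs at this ⊢ <;> simpa [rmul] using this
    | cons k l ih =>
      have e : (if i = k then scal α φ (rmul α θ j (word K l)) else 0) =
          if i = k then char φ (α j) • rmul α θ j (scal α φ (word K l)) else 0 := by
        simp only [rmul_scal]
      rw [word_cons, rmul_ι_mul, map_smul, skewDer_ι_mul, skewDer_ι_mul, ih, map_add, rmul_ι_mul, e]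
      have e' : char θ (α k) • (if i = k then char φ (α j) • rmul α θ j (scal α φ (word K l))
          else 0) = rmul α θ j (if i = k then scal α φ (word K l) else 0) := by
        split_ifs with hk
        · rw [smul_smul, ← hk, mul_comm, h, one_smul]
        · simp
      rw [smul_add, e', mul_add, smul_add, add_assoc]
      congr 2
      split_ifs
      · rw [scal_ι_mul]
      · simp
  have := congr($this Y)
  split_ifs at this ⊢ <;> simpa using this

end Words

section Pairing

variable (χ : A →+ A →+ Additive Kˣ) (α : Module.Basis I ℤ A)

/-! ### The Drinfeld pairing on the free algebras -/

theorem BorelNeg.induction {p : BorelNeg χ α → Prop} (halg : ∀ r, p (algebraMap K _ r))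
    (hgen : ∀ g, p (BorelNeg.gen χ α g)) (hadd : ∀ x y, p x → p y → p (x + y))
    (hmul : ∀ x y, p x → p y → p (x * y)) (z : BorelNeg χ α) : p z := by
  obtain ⟨z, rfl⟩ := RingQuot.mkAlgHom_surjective K _ z
  induction z using FreeAlgebra.induction with
  | grade0 r => rw [AlgHom.commutes]; exact halg r
  | grade1 x => exact hgen x
  | mul x y hx hy => rw [map_mul]; exact hmul _ _ hx hy
  | add x y hx hy => rw [map_add]; exact hadd _ _ hx hy

@[simp] theorem BorelNeg.ofRoot_ι (i : I) :
    BorelNeg.ofRoot χ α (FreeAlgebra.ι K i) = BorelNeg.gen χ α (.root i) := by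
  simp [BorelNeg.ofRoot]

/-- The contraction `x ⊗ y ↦ f(x) y`. -/
def contract (f : BorelNeg χ α →ₗ[K] K) : BorelNeg χ α ⊗[K] BorelNeg χ α →ₗ[K] BorelNeg χ α :=
  TensorProduct.lift (LinearMap.lsmul K (BorelNeg χ α) ∘ₗ f)

@[simp] theorem contract_tmul (f : BorelNeg χ α →ₗ[K] K) (x y : BorelNeg χ α) :
    contract χ α f (x ⊗ₜ y) = f x • y := rfl

theorem contract_counit (z : BorelNeg χ α) :
    contract χ α (BorelNeg.counit χ α).toLinearMap (BorelNeg.comul χ α z) = z := by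
  have h := Coalgebra.rTensor_counit_comul (R := K) z
  have h' := congr(TensorProduct.lid K _ $h)
  rw [TensorProduct.lid_tmul, one_smul] at h'
  refine Eq.trans ?_ h'
  change contract χ α _ (BorelNeg.comul χ α z) = TensorProduct.lid K _
    (LinearMap.rTensor _ (BorelNeg.counit χ α).toLinearMap (BorelNeg.comul χ α z))
  generalize BorelNeg.comul χ α z = t
  induction t with
  | zero => simp
  | tmul x y => simp
  | add x y hx hy => simp only [map_add, hx, hy]

theorem tor_mul_ofRoot (a : A) (Y : FreeAlgebra K I) :
    BorelNeg.gen χ α (.tor a) * BorelNeg.ofRoot χ α Y =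
      BorelNeg.ofRoot χ α (scal α (χ.flip a) Y) * BorelNeg.gen χ α (.tor a) := by
  have : LinearMap.mulLeft K (BorelNeg.gen χ α (.tor a)) ∘ₗ (BorelNeg.ofRoot χ α).toLinearMap =
      LinearMap.mulRight K (BorelNeg.gen χ α (.tor a)) ∘ₗ (BorelNeg.ofRoot χ α).toLinearMap ∘ₗ
        scal α (χ.flip a) := by
    refine linearMap_ext_word fun l => ?_
    simp only [LinearMap.comp_apply, LinearMap.mulLeft_apply, LinearMap.mulRight_apply,
      AlgHom.toLinearMap_apply]
    induction l with
    | nil => simp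
    | cons i l ih =>
      rw [word_cons, scal_ι_mul, map_mul, map_smul, map_mul, BorelNeg.ofRoot_ι, ← mul_assoc,
        BorelNeg.gen_tor_root, smul_mul_assoc, mul_assoc, ih, smul_mul_assoc, mul_assoc,
        char_flip]
  simpa using congr($this Y)

theorem counit_ofRoot (Y : FreeAlgebra K I) :
    BorelNeg.counit χ α (BorelNeg.ofRoot χ α Y) = constTerm Y := by
  have : (BorelNeg.counit χ α).comp (BorelNeg.ofRoot χ α) = constTerm := by
    refine FreeAlgebra.hom_ext ?_
    funext i
    simp [BorelNeg.counit]
  exact congr($this Y)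

variable [DecidableEq I]

/-- The action of `Ũ⁺` on `Ũ⁻` by skew derivations that is adjoint to right multiplication. -/
def dualOp : FreeAlgebra K I →ₐ[K] Module.End K (FreeAlgebra K I) :=
  FreeAlgebra.lift K fun i => skewDer α (χ.flip (α i)) i

@[simp] theorem dualOp_ι (i : I) :
    dualOp χ α (FreeAlgebra.ι K i) = skewDer α (χ.flip (α i)) i := by simp [dualOp]

/-! ### Contraction of the coproduct by `E_i` -/

section contraction

theorem pairEMatrix_snd (i : I) (z : BorelNeg χ α) :
    pairEMatrix χ α i z 1 0 = 0 ∧ pairEMatrix χ α i z 1 1 = BorelNeg.counit χ α z := by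
  induction z using BorelNeg.induction with
  | halg r => simp [Matrix.algebraMap_matrix_apply]
  | hgen g => rcases g with a | j <;> simp [pairEMatrix, BorelNeg.counit]
  | hadd x y hx hy => simp [hx, hy]
  | hmul x y hx hy => simp [Matrix.mul_apply, hx, hy]

theorem pairE_root_mul (i j : I) (z : BorelNeg χ α) :
    pairE χ α i (BorelNeg.gen χ α (.root j) * z) =
      if i = j then BorelNeg.counit χ α z else 0 := by
  have h := (pairEMatrix_snd χ α i z).2
  have e : pairEMatrix χ α i (BorelNeg.gen χ α (.root j)) =
      !![0, if i = j then 1 else 0; 0, 0] := by simp [pairEMatrix]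
  simp only [pairE, LinearMap.comp_apply, AlgHom.toLinearMap_apply, map_mul, e,
    Matrix.entryLinearMap_apply, Matrix.mul_apply, Fin.sum_univ_two]
  simp [h]

theorem pairE_mul_tor (i : I) (a : A) (z : BorelNeg χ α) :
    pairE χ α i (z * BorelNeg.gen χ α (.tor a)) = pairE χ α i z := by
  have e : pairEMatrix χ α i (BorelNeg.gen χ α (.tor a)) =
      !![bichar χ (α i) a, 0; 0, 1] := by simp [pairEMatrix]
  simp only [pairE, LinearMap.comp_apply, AlgHom.toLinearMap_apply, map_mul, e,
    Matrix.entryLinearMap_apply, Matrix.mul_apply, Fin.sum_univ_two]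
  simp

/-- The contraction of the coproduct by `ϑ(E_i, ·)`. -/
def coact (i : I) : BorelNeg χ α →ₗ[K] BorelNeg χ α :=
  contract χ α (pairE χ α i) ∘ₗ (BorelNeg.comul χ α).toLinearMap

/-- Multiplying `Δ(z)` by `F_j ⊗ L_{α_j} + 1 ⊗ F_j` gives two terms. In the first, `ϑ(E_i, F_j x) =
δ_{ij} ε(x)`, so the counit axiom collapses the contraction to `z`. -/
theorem coact_root_mul (i j : I) (z : BorelNeg χ α) :
    coact χ α i (BorelNeg.gen χ α (.root j) * z) =
      (if i = j then BorelNeg.gen χ α (.tor (α j)) * z else 0) +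
        BorelNeg.gen χ α (.root j) * coact χ α i z := by
  have key : ∀ t, contract χ α (pairE χ α i) ((BorelNeg.gen χ α (.root j) ⊗ₜ
      BorelNeg.gen χ α (.tor (α j)) + 1 ⊗ₜ BorelNeg.gen χ α (.root j)) * t) =
      (if i = j then BorelNeg.gen χ α (.tor (α j)) *
        contract χ α (BorelNeg.counit χ α).toLinearMap t else 0) +
        BorelNeg.gen χ α (.root j) * contract χ α (pairE χ α i) t := by
    intro t
    induction t with
    | zero => simp
    | tmul x y =>
      rw [add_mul, Algebra.TensorProduct.tmul_mul_tmul, Algebra.TensorProduct.tmul_mul_tmul,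
        map_add, contract_tmul, contract_tmul, contract_tmul, contract_tmul, pairE_root_mul,
        one_mul, AlgHom.toLinearMap_apply]
      split_ifs <;> simp
    | add x y hx hy =>
      rw [mul_add, map_add, hx, hy, map_add, map_add, mul_add, mul_add]
      split_ifs <;> abel
  simp only [coact, LinearMap.comp_apply, AlgHom.toLinearMap_apply, map_mul,
    BorelNeg.comul_gen_root, key, contract_counit]

theorem coact_mul_tor (i : I) (a : A) (z : BorelNeg χ α) :
    coact χ α i (z * BorelNeg.gen χ α (.tor a)) =
      coact χ α i z * BorelNeg.gen χ α (.tor a) := by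
  have key : ∀ t, contract χ α (pairE χ α i) (t * (BorelNeg.gen χ α (.tor a) ⊗ₜ
      BorelNeg.gen χ α (.tor a))) =
      contract χ α (pairE χ α i) t * BorelNeg.gen χ α (.tor a) := by
    intro t
    induction t with
    | zero => simp
    | tmul x y => simp [pairE_mul_tor]
    | add x y hx hy => rw [add_mul, map_add, hx, hy, map_add, add_mul]
  simp only [coact, LinearMap.comp_apply, AlgHom.toLinearMap_apply, map_mul,
    BorelNeg.comul_gen_tor, key]

theorem coact_one (i : I) : coact χ α i 1 = 0 := by
  simp [coact, Algebra.TensorProduct.one_def, pairE]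

/-- The contraction leaves `Ũ⁻` only by a torus factor on the right. Iterating it accumulates such
factors, which is why `drinfeldPairing_ofRoot_word` carries an arbitrary trailing `L_a`; elements of
`Ũ⁺` do not see it. -/
theorem coact_ofRoot (i : I) (Y : FreeAlgebra K I) :
    coact χ α i (BorelNeg.ofRoot χ α Y) =
      BorelNeg.ofRoot χ α (skewDer α (χ.flip (α i)) i Y) * BorelNeg.gen χ α (.tor (α i)) := by
  have : coact χ α i ∘ₗ (BorelNeg.ofRoot χ α).toLinearMap =
      LinearMap.mulRight K (BorelNeg.gen χ α (.tor (α i))) ∘ₗ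
        (BorelNeg.ofRoot χ α).toLinearMap ∘ₗ skewDer α (χ.flip (α i)) i := by
    refine linearMap_ext_word fun l => ?_
    simp only [LinearMap.comp_apply, LinearMap.mulRight_apply, AlgHom.toLinearMap_apply]
    induction l with
    | nil => simp [coact_one]
    | cons j l ih =>
      rw [word_cons, map_mul, BorelNeg.ofRoot_ι, coact_root_mul, ih, skewDer_ι_mul, map_add,
        map_mul, BorelNeg.ofRoot_ι, add_mul, mul_assoc]
      congr 1
      split_ifs with h
      · rw [← h, tor_mul_ofRoot]
      · simp
  simpa using congr($this Y)

end contraction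

/-! ### The pairing through skew derivations, and stability of the radicals -/

section pairing

theorem drinfeldPairing_mul_root (X : BorelPos χ α) (i : I) (Y : BorelNeg χ α) :
    drinfeldPairing χ α (X * BorelPos.gen χ α (.root i)) Y =
      drinfeldPairing χ α X (coact χ α i Y) := by
  have e : drinfeldHom χ α (BorelPos.gen χ α (.root i)) =
      MulOpposite.op (WithConv.toConv (pairE χ α i)) := by simp [drinfeldHom]
  rw [drinfeldPairing, map_mul, e, MulOpposite.unop_mul, MulOpposite.unop_op]
  change LinearMap.mul' K K (TensorProduct.map (pairE χ α i) _ (BorelNeg.comul χ α Y)) =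
    ((drinfeldHom χ α X).unop) (contract χ α (pairE χ α i) (BorelNeg.comul χ α Y))
  generalize BorelNeg.comul χ α Y = t
  induction t with
  | zero => simp
  | tmul x y => simp
  | add x y hx hy => simp only [map_add, hx, hy]

theorem drinfeldPairing_one (Y : BorelNeg χ α) :
    drinfeldPairing χ α 1 Y = BorelNeg.counit χ α Y := by
  rw [drinfeldPairing, map_one, MulOpposite.unop_one]
  rfl

theorem drinfeldPairing_ofRoot_word (l : List I) : ∀ (Y : FreeAlgebra K I) (a : A),
    drinfeldPairing χ α (BorelPos.ofRoot χ α (word K l))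
      (BorelNeg.ofRoot χ α Y * BorelNeg.gen χ α (.tor a)) =
        constTerm (dualOp χ α (word K l) Y) := by
  induction l using List.reverseRecOn with
  | nil =>
    intro Y a
    simp [drinfeldPairing_one, counit_ofRoot]
    simp [BorelNeg.counit]
  | append_singleton l i ih =>
    intro Y a
    have e : BorelPos.ofRoot χ α (FreeAlgebra.ι K i) = BorelPos.gen χ α (.root i) := by
      simp [BorelPos.ofRoot]
    rw [word_append, word_cons, word_nil, mul_one, map_mul, map_mul, e, drinfeldPairing_mul_root,
      coact_mul_tor, coact_ofRoot, mul_assoc, BorelNeg.gen_tor_add, ih, dualOp_ι,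
      Module.End.mul_apply]

theorem drinfeldPairing_ofRoot (X Y : FreeAlgebra K I) :
    drinfeldPairing χ α (BorelPos.ofRoot χ α X) (BorelNeg.ofRoot χ α Y) =
      constTerm (dualOp χ α X Y) := by
  induction X using word_induction with
  | hword l =>
    simpa [BorelNeg.gen_tor_zero] using drinfeldPairing_ofRoot_word χ α l Y 0
  | hadd X X' h h' =>
    rw [drinfeldPairing] at h h' ⊢
    rw [map_add, map_add, map_add, LinearMap.add_apply, map_add, ← h, ← h']
    rfl
  | hsmul c X h =>
    rw [drinfeldPairing] at h ⊢
    rw [map_smul, map_smul, map_smul, LinearMap.smul_apply, map_smul, ← h]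
    rfl

theorem mem_radNeg_iff (Y : FreeAlgebra K I) :
    Y ∈ radNeg χ α ↔ ∀ X, constTerm (dualOp χ α X Y) = 0 := by
  simp [radNeg, drinfeldPairing_ofRoot]

theorem mem_radPos_iff (X : FreeAlgebra K I) :
    X ∈ radPos χ α ↔ ∀ Y, constTerm (dualOp χ α X Y) = 0 := by
  simp [radPos, drinfeldPairing_ofRoot]

theorem mem_radNeg_iff_word (Y : FreeAlgebra K I) :
    Y ∈ radNeg χ α ↔ ∀ l, constTerm (dualOp χ α (word K l) Y) = 0 := by
  rw [mem_radNeg_iff]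
  refine ⟨fun h l => h _, fun h X => ?_⟩
  induction X using word_induction with
  | hword l => exact h l
  | hadd X X' h h' => simp [h, h']
  | hsmul c X h => simp [h]

theorem mem_radPos_iff_word (X : FreeAlgebra K I) :
    X ∈ radPos χ α ↔ ∀ l, constTerm (dualOp χ α X (word K l)) = 0 := by
  rw [mem_radPos_iff]
  refine ⟨fun h l => h _, fun h Y => ?_⟩
  induction Y using word_induction with
  | hword l => exact h l
  | hadd X X' h h' => simp [h, h']
  | hsmul c X h => simp [h]

/-- Moving `T` out through a product of derivations leaves one error term per letter `E_j`. Each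
error is a scaling, and pulling it to the left past the remaining derivations produces exactly the
factors `θ(α_i)` of `leftDer`. -/
theorem dualOp_commutator (T : Module.End K (FreeAlgebra K I)) (θ : A →+ Additive Kˣ) (j : I)
    (hT : ∀ i Y, skewDer α (χ.flip (α i)) i (T Y) =
      T (skewDer α (χ.flip (α i)) i Y) + if i = j then scal α θ Y else 0)
    (X Y : FreeAlgebra K I) :
    dualOp χ α X (T Y) = T (dualOp χ α X Y) + scal α θ (dualOp χ α (leftDer α θ j X) Y) := by
  induction X using word_induction with
  | hword l =>
    induction l with
    | nil => simp
    | cons i l ih =>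
      rw [word_cons, map_mul, Module.End.mul_apply, Module.End.mul_apply, ih, map_add, dualOp_ι,
        hT, skewDer_scal, leftDer_ι_mul_word, map_add, LinearMap.add_apply, map_add, map_smul,
        map_mul, LinearMap.smul_apply, map_smul, Module.End.mul_apply, dualOp_ι, add_assoc]
      split_ifs <;> simp
  | hadd X X' h h' => simp only [map_add, LinearMap.add_apply, h, h']; abel
  | hsmul c X h => simp only [map_smul, LinearMap.smul_apply, h, smul_add]

theorem dualOp_lmul (j : I) (X Y : FreeAlgebra K I) :
    dualOp χ α X (FreeAlgebra.ι K j * Y) = FreeAlgebra.ι K j * dualOp χ α X Y +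
      scal α (χ.flip (α j)) (dualOp χ α (leftDer α (χ.flip (α j)) j X) Y) := by
  refine dualOp_commutator χ α (lmul j) _ j (fun i Y => ?_) X Y
  rw [LinearMap.mulLeft_apply, skewDer_ι_mul, LinearMap.mulLeft_apply, add_comm]
  congr 1
  split_ifs with h
  · rw [h]
  · rfl

theorem bichar_mul_char_neg (a b : A) : bichar χ a b * char (-χ a) b = 1 := by
  rw [mul_comm, ← char_apply, char_neg_mul_char]

theorem dualOp_rmul (j : I) (X Y : FreeAlgebra K I) :
    dualOp χ α X (rmul α (-χ (α j)) j Y) = rmul α (-χ (α j)) j (dualOp χ α X Y) +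
      scal α (-χ (α j)) (dualOp χ α (leftDer α (-χ (α j)) j X) Y) :=
  dualOp_commutator χ α _ _ j (fun i Y => skewDer_rmul α _ _ i j
    (by rw [char_flip, bichar_mul_char_neg]) Y) X Y

theorem dualOp_word_scal (θ : A →+ Additive Kˣ) (l : List I) (Y : FreeAlgebra K I) :
    dualOp χ α (word K l) (scal α θ Y) =
      char θ (wt α l) • scal α θ (dualOp χ α (word K l) Y) := by
  induction l with
  | nil => simp [char_zero_right]
  | cons i l ih =>
    rw [word_cons, map_mul, Module.End.mul_apply, ih, map_smul, dualOp_ι, skewDer_scal, smul_smul,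
      wt_cons, char_add_right, mul_comm, Module.End.mul_apply]

theorem dualOp_word_skewDer (i : I) (l : List I) (Y : FreeAlgebra K I) :
    dualOp χ α (word K l) (skewDer α (-χ (α i)) i Y) =
      char (-χ (α i)) (wt α l) • skewDer α (-χ (α i)) i (dualOp χ α (word K l) Y) := by
  induction l with
  | nil => simp [char_zero_right]
  | cons j l ih =>
    have h : char (χ.flip (α j)) (α i) * char (-χ (α i)) (α j) = 1 := by
      rw [char_flip, bichar_mul_char_neg]
    rw [word_cons, map_mul, Module.End.mul_apply, ih, map_smul, dualOp_ι, wt_cons, char_add_right,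
      Module.End.mul_apply, skewDer_skewDer α _ _ i j h, smul_smul, mul_right_comm,
      mul_comm (char _ (α j)), h, one_mul]

/-- Under the constant term the summand beginning with `F_j` disappears, so left multiplication by
`F_j` is adjoint to a `leftDer` on `Ũ⁺`. The next lemma is the same argument for twisted right
multiplication. -/
theorem lmul_mem_radNeg (j : I) {Y : FreeAlgebra K I} (hY : Y ∈ radNeg χ α) :
    FreeAlgebra.ι K j * Y ∈ radNeg χ α := by
  rw [mem_radNeg_iff] at hY ⊢
  intro X
  rw [dualOp_lmul, map_add, constTerm_scal, hY, map_mul, constTerm_ι, zero_mul, add_zero]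

theorem rmul_mem_radNeg (j : I) {Y : FreeAlgebra K I} (hY : Y ∈ radNeg χ α) :
    rmul α (-χ (α j)) j Y ∈ radNeg χ α := by
  rw [mem_radNeg_iff] at hY ⊢
  intro X
  rw [dualOp_rmul, map_add, constTerm_scal, hY, constTerm_rmul, add_zero]

theorem scal_mem_radNeg (θ : A →+ Additive Kˣ) {Y : FreeAlgebra K I} (hY : Y ∈ radNeg χ α) :
    scal α θ Y ∈ radNeg χ α := by
  rw [mem_radNeg_iff_word] at hY ⊢
  intro l
  rw [dualOp_word_scal, map_smul, constTerm_scal, hY, smul_zero]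

theorem mul_mem_radNeg {Y : FreeAlgebra K I} (hY : Y ∈ radNeg χ α) (Z : FreeAlgebra K I) :
    Y * Z ∈ radNeg χ α := by
  induction Z using FreeAlgebra.induction generalizing Y with
  | grade0 r =>
    rw [mem_radNeg_iff] at hY ⊢
    intro X
    rw [← Algebra.commutes, ← Algebra.smul_def, map_smul, map_smul, hY, smul_zero]
  | grade1 j =>
    -- Scaling by `χ (α j)` beforehand cancels the twist in `rmul`, leaving plain right
    -- multiplication by `F_j`.
    have h := rmul_mem_radNeg χ α j (scal_mem_radNeg χ α (χ (α j)) hY)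
    rw [rmul, LinearMap.comp_apply, ← Module.End.mul_apply (scal _ _), ← scal_add,
      show -χ (α j) + χ (α j) = 0 by ext; simp, scal_zero] at h
    exact h
  | mul Z Z' h h' => rw [← mul_assoc]; exact h' (h hY)
  | add Z Z' h h' =>
    have h1 := (mem_radNeg_iff χ α _).1 (h hY)
    have h2 := (mem_radNeg_iff χ α _).1 (h' hY)
    rw [mem_radNeg_iff]
    intro X
    rw [mul_add, map_add, map_add, h1, h2, add_zero]

/-- This derivation is adjoint to right multiplication by `E_i`. -/
theorem skewDerL_mem_radNeg (i : I) {Y : FreeAlgebra K I} (hY : Y ∈ radNeg χ α) :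
    skewDer α (χ.flip (α i)) i Y ∈ radNeg χ α := by
  rw [mem_radNeg_iff] at hY ⊢
  intro X
  simpa using hY (X * FreeAlgebra.ι K i)

/-- Up to a scalar on each word, this derivation is adjoint to left multiplication by `E_i`: it
commutes with `dualOp` up to that scalar, and once outermost it has the same constant term as the
`L`-type derivation. -/
theorem skewDerK_mem_radNeg (i : I) {Y : FreeAlgebra K I} (hY : Y ∈ radNeg χ α) :
    skewDer α (-χ (α i)) i Y ∈ radNeg χ α := by
  have h := (mem_radNeg_iff χ α Y).1 hY
  rw [mem_radNeg_iff_word]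
  intro l
  rw [dualOp_word_skewDer, map_smul, constTerm_skewDer α _ (χ.flip (α i))]
  have := h (FreeAlgebra.ι K i * word K l)
  rw [map_mul, dualOp_ι, Module.End.mul_apply] at this
  rw [this, smul_zero]

/-- The adjunctions above read from the other side. This derivation and the one in the next lemma
are those arising when `X` is commuted past `F_j` in `Ũ` (`Tilde.ofPos_mul_F`), so their stability
makes the radical act by zero. -/
theorem leftDerL_mem_radPos (j : I) {X : FreeAlgebra K I} (hX : X ∈ radPos χ α) :
    leftDer α (χ.flip (α j)) j X ∈ radPos χ α := by
  rw [mem_radPos_iff] at hX ⊢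
  intro Y
  have h := hX (FreeAlgebra.ι K j * Y)
  rwa [dualOp_lmul, map_add, constTerm_scal, map_mul, constTerm_ι, zero_mul, zero_add] at h

theorem leftDerK_mem_radPos (j : I) {X : FreeAlgebra K I} (hX : X ∈ radPos χ α) :
    leftDer α (-χ (α j)) j X ∈ radPos χ α := by
  rw [mem_radPos_iff] at hX ⊢
  intro Y
  have h := hX (rmul α (-χ (α j)) j Y)
  rwa [dualOp_rmul, map_add, constTerm_scal, constTerm_rmul, zero_add] at h

theorem constTerm_of_mem_radNeg {Y : FreeAlgebra K I} (hY : Y ∈ radNeg χ α) :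
    constTerm Y = 0 := by
  simpa using (mem_radNeg_iff χ α Y).1 hY 1

end pairing

end Pairing

section Verma

variable [DecidableEq I] (χ : A →+ A →+ Additive Kˣ) (α : Module.Basis I ℤ A)

/-! ### The universal Verma module -/

/-- The radical `Ĩ⁻` as a submodule. -/
def radNegSubmodule : Submodule K (FreeAlgebra K I) where
  carrier := radNeg χ α
  add_mem' {x y} hx hy := by
    rw [mem_radNeg_iff] at hx hy ⊢
    intro X
    rw [map_add, map_add, hx, hy, add_zero]
  zero_mem' := by
    rw [mem_radNeg_iff]
    simp
  smul_mem' c x hx := by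
    rw [mem_radNeg_iff] at hx ⊢
    intro X
    rw [map_smul, map_smul, hx, smul_zero]

/-- The quotient `U⁻ = Ũ⁻ / Ĩ⁻`. -/
def NegQuot : Type (max u w) := FreeAlgebra K I ⧸ radNegSubmodule χ α

instance : AddCommGroup (NegQuot χ α) := inferInstanceAs (AddCommGroup (_ ⧸ radNegSubmodule χ α))
instance : Module K (NegQuot χ α) := inferInstanceAs (Module K (_ ⧸ radNegSubmodule χ α))

/-- The projection `Ũ⁻ → U⁻`. -/
def NegQuot.mk : FreeAlgebra K I →ₗ[K] NegQuot χ α := (radNegSubmodule χ α).mkQ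

/-! ### Operators induced on `U⁻` -/

namespace NegQuot

theorem mk_surjective : Function.Surjective (mk χ α) := Submodule.mkQ_surjective _

theorem mk_eq_zero {Y : FreeAlgebra K I} : mk χ α Y = 0 ↔ Y ∈ radNeg χ α :=
  Submodule.Quotient.mk_eq_zero _

theorem hom_ext {M : Type*} [AddCommMonoid M] [Module K M] {f g : NegQuot χ α →ₗ[K] M}
    (h : ∀ l, f (mk χ α (word K l)) = g (mk χ α (word K l))) : f = g :=
  LinearMap.ext fun x => by
    obtain ⟨Y, rfl⟩ := mk_surjective χ α x
    induction Y using word_induction with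
    | hword l => exact h l
    | hadd X X' h h' => rw [map_add, map_add, map_add, h, h']
    | hsmul c X h => rw [map_smul, map_smul, map_smul, h]

theorem hom_ext' {M : Type*} [AddCommMonoid M] [Module K M] {f g : NegQuot χ α →ₗ[K] M}
    (h : ∀ Y, f (mk χ α Y) = g (mk χ α Y)) : f = g :=
  hom_ext χ α fun _ => h _

/-- The constant term on `U⁻`. -/
def const : NegQuot χ α →ₗ[K] K :=
  (radNegSubmodule χ α).liftQ constTerm.toLinearMap fun _ h => constTerm_of_mem_radNeg χ α h

@[simp] theorem const_mk (Y : FreeAlgebra K I) : const χ α (mk χ α Y) = constTerm Y := rfl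

/-- The scaling operators on `U⁻`. -/
def scal (θ : A →+ Additive Kˣ) : Module.End K (NegQuot χ α) :=
  Submodule.mapQ _ _ (GenQuantumGroup.scal α θ) fun _ h => scal_mem_radNeg χ α θ h

/-- Multiplication by `F_i` on `U⁻`. -/
def lmul (i : I) : Module.End K (NegQuot χ α) :=
  Submodule.mapQ _ _ (GenQuantumGroup.lmul i) fun _ h => lmul_mem_radNeg χ α i h

/-- The skew derivation of `U⁻` accompanying `L_{α_i}`. -/
def derL (i : I) : Module.End K (NegQuot χ α) :=
  Submodule.mapQ _ _ (skewDer α (χ.flip (α i)) i) fun _ h => skewDerL_mem_radNeg χ α i h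

/-- The skew derivation of `U⁻` accompanying `K_{α_i}`. -/
def derK (i : I) : Module.End K (NegQuot χ α) :=
  Submodule.mapQ _ _ (skewDer α (-χ (α i)) i) fun _ h => skewDerK_mem_radNeg χ α i h

@[simp] theorem scal_mk (θ : A →+ Additive Kˣ) (Y : FreeAlgebra K I) :
    scal χ α θ (mk χ α Y) = mk χ α (GenQuantumGroup.scal α θ Y) := rfl

@[simp] theorem lmul_mk (i : I) (Y : FreeAlgebra K I) :
    lmul χ α i (mk χ α Y) = mk χ α (FreeAlgebra.ι K i * Y) := rfl

@[simp] theorem derL_mk (i : I) (Y : FreeAlgebra K I) :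
    derL χ α i (mk χ α Y) = mk χ α (skewDer α (χ.flip (α i)) i Y) := rfl

@[simp] theorem derK_mk (i : I) (Y : FreeAlgebra K I) :
    derK χ α i (mk χ α Y) = mk χ α (skewDer α (-χ (α i)) i Y) := rfl

theorem scal_zero : scal χ α 0 = 1 := hom_ext' χ α fun Y => by
  rw [scal_mk, GenQuantumGroup.scal_zero]; rfl

theorem scal_mul_scal (θ φ : A →+ Additive Kˣ) :
    scal χ α θ * scal χ α φ = scal χ α (θ + φ) := hom_ext' χ α fun Y => by
  simp [scal_add]

theorem scal_mul_lmul (θ : A →+ Additive Kˣ) (i : I) :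
    scal χ α θ * lmul χ α i = char θ (α i) • (lmul χ α i * scal χ α θ) := hom_ext' χ α fun Y => by
  simp [scal_ι_mul]

theorem derL_mul_scal (θ : A →+ Additive Kˣ) (i : I) :
    derL χ α i * scal χ α θ = char θ (α i) • (scal χ α θ * derL χ α i) := hom_ext' χ α fun Y => by
  simp [skewDer_scal]

theorem derK_mul_scal (θ : A →+ Additive Kˣ) (i : I) :
    derK χ α i * scal χ α θ = char θ (α i) • (scal χ α θ * derK χ α i) := hom_ext' χ α fun Y => by
  simp [skewDer_scal]

theorem derL_mul_lmul (i j : I) :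
    derL χ α i * lmul χ α j =
      (if i = j then scal χ α (χ.flip (α i)) else 0) + lmul χ α j * derL χ α i :=
  hom_ext' χ α fun Y => by
    split_ifs with h <;> simp [skewDer_ι_mul, h]

theorem derK_mul_lmul (i j : I) :
    derK χ α i * lmul χ α j =
      (if i = j then scal χ α (-χ (α i)) else 0) + lmul χ α j * derK χ α i :=
  hom_ext' χ α fun Y => by
    split_ifs with h <;> simp [skewDer_ι_mul, h]

end NegQuot

theorem bichar_neg_left_mul (a b : A) : bichar χ (-a) b * bichar χ a b = 1 := by
  rw [← bichar_add_left, neg_add_cancel, bichar_zero_left]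

theorem bichar_neg_right_mul (a b : A) : bichar χ a (-b) * bichar χ a b = 1 := by
  rw [← bichar_add_right, neg_add_cancel, bichar_zero_right]

/-- The algebra in which `U` is represented: polynomials in the torus with coefficients
the operators on `U⁻`. -/
abbrev TorusEnd : Type (max u v w) := AddMonoidAlgebra (Module.End K (NegQuot χ α)) (A × A)

open AddMonoidAlgebra (single)

/-- The action of the generators on the universal Verma module. -/
def genAct : Gen A I → TorusEnd χ α
  | .K a => single (a, 0) (NegQuot.scal χ α (-χ a))
  | .L a => single (0, a) (NegQuot.scal χ α (χ.flip a))
  | .E i => single (0, α i) (NegQuot.derL χ α i) - single (α i, 0) (NegQuot.derK χ α i)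
  | .F i => single 0 (NegQuot.lmul χ α i)

theorem genAct_rel {x y : FreeAlgebra K (Gen A I)} (h : TildeRel χ α x y) :
    FreeAlgebra.lift K (genAct χ α) x = FreeAlgebra.lift K (genAct χ α) y := by
  open NegQuot AddMonoidAlgebra in
  cases h with
  | K_zero =>
    rw [FreeAlgebra.lift_ι_apply, genAct, map_one, map_zero,
      show -(0 : A →+ Additive Kˣ) = 0 by ext; simp, NegQuot.scal_zero]
    rfl
  | L_zero =>
    rw [FreeAlgebra.lift_ι_apply, genAct, map_one, map_zero, NegQuot.scal_zero]
    rfl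
  | K_add a b =>
    rw [map_mul, FreeAlgebra.lift_ι_apply, FreeAlgebra.lift_ι_apply, FreeAlgebra.lift_ι_apply,
      genAct, genAct, genAct, single_mul_single, scal_mul_scal, Prod.mk_add_mk, add_zero,
      show -χ a + -χ b = -χ (a + b) by ext; simp [mul_comm]]
  | L_add a b => simp [genAct, single_mul_single, scal_mul_scal]
  | K_L a b =>
    simp only [map_mul, FreeAlgebra.lift_ι_apply, genAct, single_mul_single, scal_mul_scal,
      Prod.mk_add_mk, add_zero, zero_add,
      show -χ a + χ.flip b = χ.flip b + -χ a by ext; simp [mul_comm]]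
  | K_E a i =>
    simp only [map_mul, map_smul, FreeAlgebra.lift_ι_apply, genAct, sub_mul, mul_sub,
      single_mul_single, derL_mul_scal, derK_mul_scal, Prod.mk_add_mk, add_zero, zero_add,
      smul_sub, smul_single, smul_smul, char_neg_apply, mul_comm (bichar χ a (α i)),
      bichar_neg_right_mul, one_smul, add_comm a]
  | L_E a i =>
    simp only [map_mul, map_smul, FreeAlgebra.lift_ι_apply, genAct, sub_mul, mul_sub,
      single_mul_single, derL_mul_scal, derK_mul_scal, Prod.mk_add_mk, add_zero, zero_add,
      smul_sub, smul_single, smul_smul, char_flip,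
      bichar_neg_left_mul, one_smul, add_comm a]
  | K_F a i =>
    simp only [map_mul, map_smul, FreeAlgebra.lift_ι_apply, genAct, single_mul_single,
      scal_mul_lmul, add_zero, zero_add, smul_single, char_neg_apply]
  | L_F a i =>
    simp only [map_mul, map_smul, FreeAlgebra.lift_ι_apply, genAct, single_mul_single,
      scal_mul_lmul, add_zero, zero_add, smul_single, char_flip]
  -- The terms in which a derivation passes `F_j` cancel. What survives for `i = j` is the scaling
  -- from each derivation, and the twists `χ.flip (α i)` and `-χ (α i)` are exactly the actions of
  -- `L_{α_i}` and `K_{α_i}`.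
  | E_F i j =>
    simp only [map_mul, map_sub, FreeAlgebra.lift_ι_apply, genAct, sub_mul, mul_sub,
      single_mul_single, derL_mul_lmul, derK_mul_lmul, add_zero, zero_add, single_add]
    split_ifs with h
    · simp only [map_add, map_neg, FreeAlgebra.lift_ι_apply, genAct]
      abel
    · simp

/-- The representation of `Ũ` on the universal Verma module. -/
def repTilde : Tilde χ α →ₐ[K] TorusEnd χ α :=
  RingQuot.liftAlgHom K ⟨FreeAlgebra.lift K (genAct χ α), fun _ _ h => genAct_rel χ α h⟩

@[simp] theorem repTilde_gen (g : Gen A I) : repTilde χ α (Tilde.gen χ α g) = genAct χ α g := by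
  refine (RingQuot.liftAlgHom_mkAlgHom_apply K _ _ _).trans ?_
  simp

/-! ### Relations in `Ũ` -/

namespace Tilde

theorem rel {x y : FreeAlgebra K (Gen A I)} (h : TildeRel χ α x y) :
    RingQuot.mkAlgHom K (TildeRel χ α) x = RingQuot.mkAlgHom K (TildeRel χ α) y :=
  RingQuot.mkAlgHom_rel K h

theorem K_zero : gen χ α (.K 0) = 1 :=
  (rel χ α .K_zero).trans (map_one _)

theorem L_zero : gen χ α (.L 0) = 1 :=
  (rel χ α .L_zero).trans (map_one _)

theorem K_mul_K (a b : A) : gen χ α (.K a) * gen χ α (.K b) = gen χ α (.K (a + b)) := by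
  have h := rel χ α (.K_add a b)
  rwa [map_mul] at h

theorem L_mul_L (a b : A) : gen χ α (.L a) * gen χ α (.L b) = gen χ α (.L (a + b)) := by
  have h := rel χ α (.L_add a b)
  rwa [map_mul] at h

theorem K_mul_L (a b : A) :
    gen χ α (.K a) * gen χ α (.L b) = gen χ α (.L b) * gen χ α (.K a) := by
  have h := rel χ α (.K_L a b)
  rwa [map_mul, map_mul] at h

theorem K_mul_E (a : A) (i : I) : gen χ α (.K a) * gen χ α (.E i) =
    bichar χ a (α i) • (gen χ α (.E i) * gen χ α (.K a)) := by
  have h := rel χ α (.K_E a i)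
  rwa [map_smul, map_mul, map_mul] at h

theorem L_mul_E (a : A) (i : I) : gen χ α (.L a) * gen χ α (.E i) =
    bichar χ (-α i) a • (gen χ α (.E i) * gen χ α (.L a)) := by
  have h := rel χ α (.L_E a i)
  rwa [map_smul, map_mul, map_mul] at h

theorem K_mul_F (a : A) (i : I) : gen χ α (.K a) * gen χ α (.F i) =
    bichar χ a (-α i) • (gen χ α (.F i) * gen χ α (.K a)) := by
  have h := rel χ α (.K_F a i)
  rwa [map_smul, map_mul, map_mul] at h

theorem L_mul_F (a : A) (i : I) : gen χ α (.L a) * gen χ α (.F i) =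
    bichar χ (α i) a • (gen χ α (.F i) * gen χ α (.L a)) := by
  have h := rel χ α (.L_F a i)
  rwa [map_smul, map_mul, map_mul] at h

theorem E_mul_F (i j : I) : gen χ α (.E i) * gen χ α (.F j) =
    gen χ α (.F j) * gen χ α (.E i) +
      if i = j then gen χ α (.L (α i)) - gen χ α (.K (α i)) else 0 := by
  have h := rel χ α (.E_F i j)
  rw [map_sub, sub_eq_iff_eq_add', map_mul, map_mul] at h
  refine h.trans ?_
  congr 1
  split_ifs
  · rw [map_add, map_neg, neg_add_eq_sub]; rfl
  · simp

theorem E_mul_K (a : A) (i : I) : gen χ α (.E i) * gen χ α (.K a) =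
    char (-χ a) (α i) • (gen χ α (.K a) * gen χ α (.E i)) := by
  rw [K_mul_E, smul_smul, char_neg_apply, bichar_neg_right_mul, one_smul]

theorem E_mul_L (a : A) (i : I) : gen χ α (.E i) * gen χ α (.L a) =
    char (χ.flip a) (α i) • (gen χ α (.L a) * gen χ α (.E i)) := by
  rw [L_mul_E, smul_smul, char_flip, mul_comm, bichar_neg_left_mul, one_smul]

@[simp] theorem ofPos_ι (i : I) : ofPos χ α (FreeAlgebra.ι K i) = gen χ α (.E i) := by
  simp [ofPos]

@[simp] theorem ofNeg_ι (i : I) : ofNeg χ α (FreeAlgebra.ι K i) = gen χ α (.F i) := by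
  simp [ofNeg]

theorem ofPos_mul_F (X : FreeAlgebra K I) (j : I) :
    ofPos χ α X * gen χ α (.F j) = gen χ α (.F j) * ofPos χ α X +
      gen χ α (.L (α j)) * ofPos χ α (leftDer α (χ.flip (α j)) j X) -
      gen χ α (.K (α j)) * ofPos χ α (leftDer α (-χ (α j)) j X) := by
  induction X using word_induction with
  | hword l =>
    induction l with
    | nil => simp
    | cons i l ih =>
      rw [word_cons, map_mul, mul_assoc, ih, leftDer_ι_mul_word, leftDer_ι_mul_word, ofPos_ι,
        mul_sub, mul_add, ← mul_assoc, ← mul_assoc, ← mul_assoc, E_mul_F, E_mul_L, E_mul_K,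
        map_add, map_add, map_smul, map_smul, map_mul, map_mul, ofPos_ι, mul_add, mul_add,
        mul_smul_comm, mul_smul_comm, smul_mul_assoc, smul_mul_assoc, add_mul]
      simp only [mul_assoc]
      split_ifs with h
      · rw [h, sub_mul]; abel
      · simp
  | hadd X X' h h' => simp only [map_add, add_mul, mul_add, h, h']; abel
  | hsmul c X h => simp only [map_smul, smul_mul_assoc, mul_smul_comm, h, smul_sub, smul_add]

end Tilde

/-! ### The representation of `U` -/

/-- Elements of `Ũ⁻` involve no torus exponent and act by left multiplication on `U⁻`. -/
theorem repTilde_ofNeg (Y : FreeAlgebra K I) :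
    ∃ f, repTilde χ α (Tilde.ofNeg χ α Y) = single 0 f ∧
      ∀ Z, f (NegQuot.mk χ α Z) = NegQuot.mk χ α (Y * Z) := by
  induction Y using FreeAlgebra.induction with
  | grade0 r =>
    refine ⟨algebraMap K _ r, ?_, fun _ => ?_⟩
    · rw [AlgHom.commutes, AlgHom.commutes]; rfl
    · rw [Module.algebraMap_end_apply, ← Algebra.smul_def, map_smul]
  | grade1 i => exact ⟨NegQuot.lmul χ α i, by simp [genAct], fun _ => rfl⟩
  | mul Y Y' h h' =>
    obtain ⟨f, hf, hf'⟩ := h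
    obtain ⟨g, hg, hg'⟩ := h'
    exact ⟨f * g, by rw [map_mul, map_mul, hf, hg, AddMonoidAlgebra.single_mul_single, add_zero],
      fun Z => by rw [Module.End.mul_apply, hg', hf', mul_assoc]⟩
  | add Y Y' h h' =>
    obtain ⟨f, hf, hf'⟩ := h
    obtain ⟨g, hg, hg'⟩ := h'
    exact ⟨f + g, by rw [map_add, map_add, hf, hg, AddMonoidAlgebra.single_add],
      fun Z => by rw [LinearMap.add_apply, hg', hf', add_mul, map_add]⟩

/-- The vector `1` is a highest weight vector: both skew derivations kill it. -/
theorem coeff_mul_E_mk_one (r : TorusEnd χ α) (i : I) (g : A × A) :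
    (r * genAct χ α (.E i)).coeff g (NegQuot.mk χ α 1) = 0 := by
  rw [genAct, mul_sub, AddMonoidAlgebra.coeff_sub, Finsupp.sub_apply,
    AddMonoidAlgebra.coeff_mul_single_apply, AddMonoidAlgebra.coeff_mul_single_apply]
  simp

open Classical in
theorem repTilde_ofPos_mk_one (X : FreeAlgebra K I) (g : A × A) :
    (repTilde χ α (Tilde.ofPos χ α X)).coeff g (NegQuot.mk χ α 1) =
      if g = 0 then constTerm X • NegQuot.mk χ α 1 else 0 := by
  induction X using word_induction with
  | hword l =>
    induction l using List.reverseRecOn with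
    | nil =>
      rw [word_nil, map_one (Tilde.ofPos χ α), map_one, map_one constTerm, AddMonoidAlgebra.one_def,
        AddMonoidAlgebra.coeff_single, Finsupp.single_apply]
      simp only [eq_comm (a := g)]
      split_ifs <;> simp
    | append_singleton l i _ =>
      rw [word_append, map_mul, map_mul, word_cons, word_nil, mul_one, Tilde.ofPos_ι, repTilde_gen,
        coeff_mul_E_mk_one, map_mul, constTerm_ι]
      simp
  | hadd X X' h h' =>
    rw [map_add, map_add, AddMonoidAlgebra.coeff_add, Finsupp.add_apply, LinearMap.add_apply, h, h']
    split_ifs <;> simp [add_smul]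
  | hsmul c X h =>
    rw [map_smul, map_smul, AddMonoidAlgebra.coeff_smul_apply, LinearMap.smul_apply, h]
    split_ifs <;> simp [smul_smul]

/-- Commuting `X` past the first letter `F_j` yields `X` and two derivatives of it, all in the
radical, acting on a shorter word; hence the induction runs over all `X` at once. On the vector `1`
only the constant term of `X` survives, and it is the pairing of `X` with `1`. -/
theorem repTilde_ofPos_of_mem (l : List I) : ∀ X ∈ radPos χ α, ∀ g,
    (repTilde χ α (Tilde.ofPos χ α X)).coeff g (NegQuot.mk χ α (word K l)) = 0 := by
  induction l with
  | nil =>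
    intro X hX g
    have := (mem_radPos_iff χ α X).1 hX 1
    have hc : ∀ X : FreeAlgebra K I, constTerm (dualOp χ α X 1) = constTerm X := by
      intro X
      induction X using word_induction with
      | hword l =>
        cases l using List.reverseRecOn with
        | nil => simp
        | append_singleton l i => simp [word_append]
      | hadd X X' h h' => simp [h, h']
      | hsmul c X h => simp [h]
    rw [word_nil, repTilde_ofPos_mk_one, ← hc, this]
    simp
  | cons j l ih =>
    intro X hX g
    have h := congr(repTilde χ α $(Tilde.ofPos_mul_F χ α X j))
    simp only [map_add, map_mul, map_sub, repTilde_gen, genAct] at h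
    have h' := congr(($h).coeff g (NegQuot.mk χ α (word K l)))
    simp only [AddMonoidAlgebra.coeff_sub, AddMonoidAlgebra.coeff_add, Finsupp.sub_apply,
      Finsupp.add_apply, LinearMap.add_apply, LinearMap.sub_apply,
      AddMonoidAlgebra.coeff_mul_single_apply, AddMonoidAlgebra.coeff_single_mul_apply,
      Module.End.mul_apply, NegQuot.lmul_mk] at h'
    rw [ih X hX, ih _ (leftDerL_mem_radPos χ α j hX), ih _ (leftDerK_mem_radPos χ α j hX)] at h'
    simpa using h'

/-- The representation of `U` on the universal Verma module. -/
def rep : U χ α →ₐ[K] TorusEnd χ α :=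
  RingQuot.liftAlgHom K ⟨repTilde χ α, by
    rintro _ _ (⟨X, hX⟩ | ⟨Y, hY⟩)
    · rw [map_zero, ← AddMonoidAlgebra.coeff_eq_zero]
      ext1 g
      exact NegQuot.hom_ext χ α fun l => repTilde_ofPos_of_mem χ α l X hX g
    -- An element of the negative radical acts by left multiplication, which is zero on `U⁻` because
    -- the radical is a right ideal.
    · obtain ⟨f, hf, hf'⟩ := repTilde_ofNeg χ α Y
      rw [hf, map_zero, AddMonoidAlgebra.single_eq_zero]
      exact NegQuot.hom_ext' χ α fun Z => (hf' Z).trans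
        ((NegQuot.mk_eq_zero χ α).2 (mul_mem_radNeg χ α hY Z))⟩

/-- The projection `Ũ → U`. -/
def U.ofTilde : Tilde χ α →ₐ[K] U χ α := RingQuot.mkAlgHom K (URel χ α)

@[simp] theorem U.ofTilde_gen (g : Gen A I) :
    U.ofTilde χ α (Tilde.gen χ α g) = U.gen χ α g := rfl

@[simp] theorem rep_ofTilde (x : Tilde χ α) : rep χ α (U.ofTilde χ α x) = repTilde χ α x :=
  RingQuot.liftAlgHom_mkAlgHom_apply K _ _ _

@[simp] theorem rep_gen (g : Gen A I) : rep χ α (U.gen χ α g) = genAct χ α g := by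
  rw [← U.ofTilde_gen, rep_ofTilde, repTilde_gen]

end Verma

section Triangular

variable [DecidableEq I] (χ : A →+ A →+ Additive Kˣ) (α : Module.Basis I ℤ A)

open AddMonoidAlgebra (single)

/-! ### Triangular spanning set of `U` and the Shapovalov map -/

namespace U

/-- The map `Ũ⁺ → U`. -/
def pos : FreeAlgebra K I →ₐ[K] U χ α := (ofTilde χ α).comp (Tilde.ofPos χ α)

/-- The map `Ũ⁻ → U`. -/
def neg : FreeAlgebra K I →ₐ[K] U χ α := (ofTilde χ α).comp (Tilde.ofNeg χ α)

@[simp] theorem pos_ι (i : I) : pos χ α (FreeAlgebra.ι K i) = gen χ α (.E i) := by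
  simp [pos]

@[simp] theorem neg_ι (i : I) : neg χ α (FreeAlgebra.ι K i) = gen χ α (.F i) := by
  simp [neg]

theorem pos_eq_zero {X : FreeAlgebra K I} (hX : X ∈ radPos χ α) : pos χ α X = 0 :=
  (RingQuot.mkAlgHom_rel K (URel.pos X hX)).trans (map_zero _)

theorem neg_eq_zero {Y : FreeAlgebra K I} (hY : Y ∈ radNeg χ α) : neg χ α Y = 0 :=
  (RingQuot.mkAlgHom_rel K (URel.neg Y hY)).trans (map_zero _)

/-- The element `K_a L_b`. -/
def torus (g : A × A) : U χ α := gen χ α (.K g.1) * gen χ α (.L g.2)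

theorem K_mul_K (a b : A) : gen χ α (.K a) * gen χ α (.K b) = gen χ α (.K (a + b)) := by
  simpa only [map_mul, ofTilde_gen] using congr(ofTilde χ α $(Tilde.K_mul_K χ α a b))

theorem L_mul_L (a b : A) : gen χ α (.L a) * gen χ α (.L b) = gen χ α (.L (a + b)) := by
  simpa only [map_mul, ofTilde_gen] using congr(ofTilde χ α $(Tilde.L_mul_L χ α a b))

theorem K_mul_L (a b : A) :
    gen χ α (.K a) * gen χ α (.L b) = gen χ α (.L b) * gen χ α (.K a) := by
  simpa only [map_mul, ofTilde_gen] using congr(ofTilde χ α $(Tilde.K_mul_L χ α a b))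

theorem K_zero : gen χ α (.K 0) = 1 := by
  simpa only [map_one, ofTilde_gen] using congr(ofTilde χ α $(Tilde.K_zero χ α))

theorem L_zero : gen χ α (.L 0) = 1 := by
  simpa only [map_one, ofTilde_gen] using congr(ofTilde χ α $(Tilde.L_zero χ α))

theorem K_mul_F (a : A) (i : I) : gen χ α (.K a) * gen χ α (.F i) =
    bichar χ a (-α i) • (gen χ α (.F i) * gen χ α (.K a)) := by
  simpa only [map_mul, map_smul, ofTilde_gen] using congr(ofTilde χ α $(Tilde.K_mul_F χ α a i))

theorem L_mul_F (a : A) (i : I) : gen χ α (.L a) * gen χ α (.F i) =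
    bichar χ (α i) a • (gen χ α (.F i) * gen χ α (.L a)) := by
  simpa only [map_mul, map_smul, ofTilde_gen] using congr(ofTilde χ α $(Tilde.L_mul_F χ α a i))

theorem E_mul_K (a : A) (i : I) : gen χ α (.E i) * gen χ α (.K a) =
    char (-χ a) (α i) • (gen χ α (.K a) * gen χ α (.E i)) := by
  simpa only [map_mul, map_smul, ofTilde_gen] using congr(ofTilde χ α $(Tilde.E_mul_K χ α a i))

theorem E_mul_L (a : A) (i : I) : gen χ α (.E i) * gen χ α (.L a) =
    char (χ.flip a) (α i) • (gen χ α (.L a) * gen χ α (.E i)) := by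
  simpa only [map_mul, map_smul, ofTilde_gen] using congr(ofTilde χ α $(Tilde.E_mul_L χ α a i))

theorem E_mul_F (i j : I) : gen χ α (.E i) * gen χ α (.F j) =
    gen χ α (.F j) * gen χ α (.E i) +
      if i = j then gen χ α (.L (α i)) + (-1 : K) • gen χ α (.K (α i)) else 0 := by
  have h := Tilde.E_mul_F χ α i j
  rw [sub_eq_add_neg, ← neg_one_smul K] at h
  replace h := congr(ofTilde χ α $h)
  split_ifs at h ⊢ <;>
    simpa only [map_mul, map_add, map_smul, map_zero, ofTilde_gen] using h

theorem K_mul_torus (a : A) (g : A × A) :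
    gen χ α (.K a) * torus χ α g = torus χ α ((a, 0) + g) := by
  rw [torus, torus, ← mul_assoc, K_mul_K, Prod.fst_add, Prod.snd_add, zero_add]

theorem L_mul_torus (a : A) (g : A × A) :
    gen χ α (.L a) * torus χ α g = torus χ α ((0, a) + g) := by
  rw [torus, torus, ← mul_assoc, ← K_mul_L, mul_assoc, L_mul_L, Prod.fst_add, Prod.snd_add,
    zero_add]

theorem torus_zero : torus χ α 0 = 1 := by
  rw [torus, Prod.fst_zero, Prod.snd_zero, K_zero, L_zero, one_mul]

theorem torus_mul_torus (g h : A × A) : torus χ α g * torus χ α h = torus χ α (g + h) := by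
  conv_lhs => rw [torus]
  rw [mul_assoc, L_mul_torus, K_mul_torus, ← add_assoc]
  simp

theorem E_mul_torus (i : I) (g : A × A) :
    ∃ c : K, gen χ α (.E i) * torus χ α g = c • (torus χ α g * gen χ α (.E i)) :=
  ⟨char (-χ g.1) (α i) * char (χ.flip g.2) (α i), by
    rw [torus, ← mul_assoc, E_mul_K, smul_mul_assoc, mul_assoc, E_mul_L, mul_smul_comm, smul_smul,
      mul_assoc]⟩

theorem K_mul_neg_word (a : A) (l : List I) : ∃ c : K,
    gen χ α (.K a) * neg χ α (word K l) = c • (neg χ α (word K l) * gen χ α (.K a)) := by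
  induction l with
  | nil => exact ⟨1, by simp⟩
  | cons i l ih =>
    obtain ⟨c, hc⟩ := ih
    exact ⟨bichar χ a (-α i) * c, by
      rw [word_cons, map_mul, neg_ι, ← mul_assoc, K_mul_F, smul_mul_assoc, mul_assoc, hc,
        mul_smul_comm, smul_smul, mul_assoc]⟩

theorem L_mul_neg_word (a : A) (l : List I) : ∃ c : K,
    gen χ α (.L a) * neg χ α (word K l) = c • (neg χ α (word K l) * gen χ α (.L a)) := by
  induction l with
  | nil => exact ⟨1, by simp⟩
  | cons i l ih =>
    obtain ⟨c, hc⟩ := ih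
    exact ⟨bichar χ (α i) a * c, by
      rw [word_cons, map_mul, neg_ι, ← mul_assoc, L_mul_F, smul_mul_assoc, mul_assoc, hc,
        mul_smul_comm, smul_smul, mul_assoc]⟩

/-- The triangular monomial `F_l K_a L_b E_m`. -/
def monomial (p : List I × (A × A) × List I) : U χ α :=
  neg χ α (word K p.1) * (torus χ α p.2.1 * pos χ α (word K p.2.2))

/-- The span of the triangular monomials. -/
def triangular : Submodule K (U χ α) := Submodule.span K (Set.range (monomial χ α))

theorem monomial_mem (p : List I × (A × A) × List I) : monomial χ α p ∈ triangular χ α :=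
  Submodule.subset_span ⟨p, rfl⟩

theorem mul_mem_triangular {x : U χ α} (h : ∀ p, x * monomial χ α p ∈ triangular χ α) {y : U χ α}
    (hy : y ∈ triangular χ α) : x * y ∈ triangular χ α := by
  have : triangular χ α ≤ (triangular χ α).comap (LinearMap.mulLeft K x) :=
    Submodule.span_le.2 (by rintro _ ⟨p, rfl⟩; exact h p)
  exact this hy

theorem gen_mul_mem_triangular (g : Gen A I) {y : U χ α} (hy : y ∈ triangular χ α) :
    gen χ α g * y ∈ triangular χ α := by
  have hF : ∀ i, ∀ y ∈ triangular χ α, gen χ α (.F i) * y ∈ triangular χ α := fun i y hy =>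
    mul_mem_triangular χ α (fun ⟨l, g, m⟩ => by
      have := monomial_mem χ α (i :: l, g, m)
      rwa [monomial, word_cons, map_mul, neg_ι, mul_assoc] at this) hy
  have hK : ∀ a, ∀ y ∈ triangular χ α, gen χ α (.K a) * y ∈ triangular χ α := fun a y hy =>
    mul_mem_triangular χ α (fun ⟨l, g, m⟩ => by
      obtain ⟨c, hc⟩ := K_mul_neg_word χ α a l
      rw [monomial, ← mul_assoc, hc, smul_mul_assoc, mul_assoc, ← mul_assoc (gen χ α (.K a)),
        K_mul_torus]
      exact Submodule.smul_mem _ _ (monomial_mem χ α (l, _, m))) hy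
  have hL : ∀ a, ∀ y ∈ triangular χ α, gen χ α (.L a) * y ∈ triangular χ α := fun a y hy =>
    mul_mem_triangular χ α (fun ⟨l, g, m⟩ => by
      obtain ⟨c, hc⟩ := L_mul_neg_word χ α a l
      rw [monomial, ← mul_assoc, hc, smul_mul_assoc, mul_assoc, ← mul_assoc (gen χ α (.L a)),
        L_mul_torus]
      exact Submodule.smul_mem _ _ (monomial_mem χ α (l, _, m))) hy
  cases g with
  | K a => exact hK a y hy
  | L a => exact hL a y hy
  | F i => exact hF i y hy
  | E i =>
    refine mul_mem_triangular χ α (fun ⟨l, g, m⟩ => ?_) hy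
    -- `E_i` is moved right through the `F`-word one letter at a time; each commutator leaves a
    -- torus element times a shorter triangular monomial.
    induction l with
    | nil =>
      obtain ⟨c, hc⟩ := E_mul_torus χ α i g
      have := monomial_mem χ α ([], g, i :: m)
      rw [monomial, word_nil, map_one, one_mul, word_cons, map_mul, pos_ι, ← mul_assoc] at this
      rw [monomial, word_nil, map_one, one_mul, ← mul_assoc, hc, smul_mul_assoc]
      exact Submodule.smul_mem _ _ this
    | cons j l ih =>
      have e : monomial χ α (j :: l, g, m) = gen χ α (.F j) * monomial χ α (l, g, m) := by
        rw [monomial, monomial, word_cons, map_mul, neg_ι, mul_assoc]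
      rw [e, ← mul_assoc, E_mul_F, add_mul, mul_assoc]
      refine add_mem (hF j _ ih) ?_
      split_ifs
      · rw [add_mul, smul_mul_assoc]
        exact add_mem (hL _ _ (monomial_mem χ α _))
          (Submodule.smul_mem _ _ (hK _ _ (monomial_mem χ α _)))
      · rw [zero_mul]; exact zero_mem _

/-- The span contains `1` and is stable under left multiplication by the generators. -/
theorem triangular_eq_top : triangular χ α = ⊤ := by
  have h1 : (1 : U χ α) ∈ triangular χ α := by
    have := monomial_mem χ α ([], 0, [])
    rwa [monomial, word_nil, map_one, map_one, torus_zero, one_mul, one_mul] at this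
  have key : ∀ x : FreeAlgebra K (Gen A I), ∀ y ∈ triangular χ α,
      FreeAlgebra.lift K (gen χ α) x * y ∈ triangular χ α := by
    intro x
    induction x using FreeAlgebra.induction with
    | grade0 r =>
      intro y hy
      rw [AlgHom.commutes, ← Algebra.smul_def]
      exact Submodule.smul_mem _ _ hy
    | grade1 g =>
      intro y hy
      rw [FreeAlgebra.lift_ι_apply]
      exact gen_mul_mem_triangular χ α g hy
    | mul x x' h h' =>
      intro y hy
      rw [map_mul, mul_assoc]
      exact h _ (h' _ hy)
    | add x x' h h' =>
      intro y hy
      rw [map_add, add_mul]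
      exact add_mem (h _ hy) (h' _ hy)
  rw [eq_top_iff]
  intro u _
  obtain ⟨v, rfl⟩ := RingQuot.mkAlgHom_surjective K _ u
  obtain ⟨x, rfl⟩ := RingQuot.mkAlgHom_surjective K _ v
  have e : (ofTilde χ α).comp (RingQuot.mkAlgHom K (TildeRel χ α)) =
      FreeAlgebra.lift K (gen χ α) := by
    refine FreeAlgebra.hom_ext ?_
    funext g
    simp only [Function.comp_apply, FreeAlgebra.lift_ι_apply]
    rfl
  have := key x 1 h1
  rw [mul_one, ← e] at this
  exact this

theorem torus_mem (g : A × A) : torus χ α g ∈ U0 χ α :=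
  mul_mem (Algebra.subset_adjoin (Or.inl ⟨_, rfl⟩)) (Algebra.subset_adjoin (Or.inr ⟨_, rfl⟩))

theorem U0_le_span {x : U χ α} (hx : x ∈ U0 χ α) :
    x ∈ Submodule.span K (Set.range (torus χ α)) := by
  induction hx using Algebra.adjoin_induction with
  | mem x hx =>
    apply Submodule.subset_span
    obtain ⟨a, rfl⟩ | ⟨a, rfl⟩ := hx
    · exact ⟨(a, 0), by simp only [torus, L_zero, mul_one]⟩
    · exact ⟨(0, a), by simp only [torus, K_zero, one_mul]⟩
  | algebraMap r =>
    rw [Algebra.algebraMap_eq_smul_one, ← torus_zero χ α]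
    exact Submodule.smul_mem _ _ (Submodule.subset_span ⟨0, rfl⟩)
  | add x y _ _ hx hy => exact add_mem hx hy
  | mul x y _ _ hx hy =>
    have : Submodule.span K (Set.range (torus χ α)) * Submodule.span K (Set.range (torus χ α)) ≤
        Submodule.span K (Set.range (torus χ α)) := by
      rw [Submodule.span_mul_span, Submodule.span_le]
      rintro _ ⟨_, ⟨g, rfl⟩, _, ⟨h, rfl⟩, rfl⟩
      exact Submodule.subset_span ⟨g + h, (torus_mul_torus χ α g h).symm⟩
    exact this (Submodule.mul_mem_mul hx hy)

end U

/-! ### Uniqueness and construction of the Shapovalov map -/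

theorem IsShapovalovMap.unique {S S' : U χ α →ₗ[K] U0 χ α} (h : IsShapovalovMap χ α S)
    (h' : IsShapovalovMap χ α S') : S = S' := by
  refine LinearMap.ext_on_range (U.triangular_eq_top χ α) ?_
  rintro ⟨l, g, m⟩
  cases l with
  | cons i l =>
    rw [U.monomial, word_cons, map_mul (U.neg χ α), U.neg_ι, mul_assoc, h.map_F_mul, h'.map_F_mul]
  | nil =>
    cases m using List.reverseRecOn with
    | nil =>
      have e : U.monomial χ α ([], g, []) = (⟨U.torus χ α g, U.torus_mem χ α g⟩ : U0 χ α) := by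
        rw [U.monomial, word_nil, map_one, map_one, one_mul, mul_one]
      rw [e, h.map_U0, h'.map_U0]
    | append_singleton m i =>
      rw [U.monomial, word_append, map_mul (U.pos χ α), word_cons, word_nil, mul_one, U.pos_ι, ← mul_assoc,
        ← mul_assoc, h.map_mul_E, h'.map_mul_E]

/-- The vacuum expectation of an operator on `U⁻`. -/
def vacuum : Module.End K (NegQuot χ α) →ₗ[K] K :=
  NegQuot.const χ α ∘ₗ LinearMap.applyₗ (NegQuot.mk χ α 1)

/-- The coefficients of the Shapovalov map. -/
def shapovalovCoeff : U χ α →ₗ[K] (A × A →₀ K) :=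
  Finsupp.mapRange.linearMap (vacuum χ α) ∘ₗ
    (AddMonoidAlgebra.coeffLinearEquiv K).toLinearMap ∘ₗ (rep χ α).toLinearMap

theorem shapovalovCoeff_apply (u : U χ α) (g : A × A) :
    shapovalovCoeff χ α u g = NegQuot.const χ α ((rep χ α u).coeff g (NegQuot.mk χ α 1)) := rfl

theorem rep_torus (g : A × A) : rep χ α (U.torus χ α g) =
    single g (NegQuot.scal χ α (-χ g.1 + χ.flip g.2)) := by
  rw [U.torus, map_mul, rep_gen, rep_gen, genAct, genAct, AddMonoidAlgebra.single_mul_single,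
    NegQuot.scal_mul_scal]
  simp

theorem shapovalovCoeff_torus (g : A × A) :
    shapovalovCoeff χ α (U.torus χ α g) = Finsupp.single g 1 := by
  ext h
  rw [shapovalovCoeff_apply, rep_torus, AddMonoidAlgebra.coeff_single]
  classical
  rw [Finsupp.single_apply, Finsupp.single_apply]
  split_ifs <;> simp

/-- The Shapovalov map. -/
def shapovalov : U χ α →ₗ[K] U0 χ α :=
  Finsupp.linearCombination K (fun g => (⟨U.torus χ α g, U.torus_mem χ α g⟩ : U0 χ α)) ∘ₗ
    shapovalovCoeff χ α

theorem isShapovalovMap_shapovalov : IsShapovalovMap χ α (shapovalov χ α) where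
  map_U0 := by
    have : ∀ z ∈ Submodule.span K (Set.range (U.torus χ α)), (shapovalov χ α z : U χ α) = z := by
      intro z hz
      induction hz using Submodule.span_induction with
      | mem x hx =>
        obtain ⟨g, rfl⟩ := hx
        simp [shapovalov, shapovalovCoeff_torus]
      | zero => simp
      | add x y _ _ hx hy => rw [map_add, Subalgebra.coe_add, hx, hy]
      | smul c x _ hx => rw [map_smul, Subalgebra.coe_smul, hx]
    exact fun z => Subtype.ext (this z (U.U0_le_span χ α z.2))
  map_mul_E X i := by
    have : shapovalovCoeff χ α (X * U.gen χ α (.E i)) = 0 := by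
      ext g
      rw [shapovalovCoeff_apply, map_mul, rep_gen, coeff_mul_E_mk_one]
      simp
    rw [shapovalov, LinearMap.comp_apply, this, map_zero]
  map_F_mul X i := by
    have : shapovalovCoeff χ α (U.gen χ α (.F i) * X) = 0 := by
      ext g
      rw [shapovalovCoeff_apply, map_mul, rep_gen, genAct,
        AddMonoidAlgebra.coeff_single_mul_apply, Module.End.mul_apply]
      obtain ⟨Y, hY⟩ := NegQuot.mk_surjective χ α ((rep χ α X).coeff (-0 + g) (NegQuot.mk χ α 1))
      rw [← hY, NegQuot.lmul_mk, NegQuot.const_mk, map_mul, constTerm_ι, zero_mul]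
      rfl
    rw [shapovalov, LinearMap.comp_apply, this, map_zero]

/-- The coefficients can be recovered from the value of the map, since the `K_a L_b` have linearly
independent coefficient vectors. Thus equal Shapovalov values give equal vacuum expectations. -/
theorem shapovalovCoeff_shapovalov (u : U χ α) :
    shapovalovCoeff χ α (shapovalov χ α u) = shapovalovCoeff χ α u := by
  have : ∀ f : A × A →₀ K, shapovalovCoeff χ α ((Finsupp.linearCombination K
      (fun g => (⟨U.torus χ α g, U.torus_mem χ α g⟩ : U0 χ α)) f : U0 χ α) : U χ α) = f := by
    intro f
    induction f using Finsupp.induction_linear with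
    | zero => simp
    | add f g hf hg => rw [map_add, Subalgebra.coe_add, map_add, hf, hg]
    | single g c => simp [shapovalovCoeff_torus]
  exact this _

end Triangular

section Faithful

variable (χ : A →+ A →+ Additive Kˣ) (α : Module.Basis I ℤ A)

open AddMonoidAlgebra (single)

/-! ### Gradings -/

/-- The height `A → ℤ` with value one on each `α_i`. -/
def height : A →ₗ[ℤ] ℤ := α.constr ℤ fun _ => (1 : ℤ)

@[simp] theorem height_basis (i : I) : height α (α i) = 1 := by simp [height]

@[simp] theorem height_wt (l : List I) : height α (wt α l) = l.length := by
  induction l with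
  | nil => simp
  | cons i l ih => simp [ih, add_comm]

theorem length_eq_of_wt_eq {l m : List I} (h : wt α l = wt α m) : l.length = m.length := by
  have := congrArg (height α) h
  simpa using this

variable (K) in
/-- The weight spaces of the free algebra. -/
def wtSpace (β : A) : Submodule K (FreeAlgebra K I) :=
  Submodule.span K (word K '' {l | wt α l = β})

theorem word_mem_wtSpace (l : List I) : word K l ∈ wtSpace K α (wt α l) :=
  Submodule.subset_span ⟨l, rfl, rfl⟩

theorem ι_mul_mem_wtSpace (i : I) {β : A} {Y : FreeAlgebra K I} (hY : Y ∈ wtSpace K α β) :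
    FreeAlgebra.ι K i * Y ∈ wtSpace K α (α i + β) := by
  have : wtSpace K α β ≤ (wtSpace K α (α i + β)).comap (lmul i) := by
    refine Submodule.span_le.2 ?_
    rintro _ ⟨l, rfl, rfl⟩
    have := word_mem_wtSpace (K := K) α (i :: l)
    rwa [word_cons, wt_cons] at this
  exact this hY

theorem scal_mem_wtSpace (θ : A →+ Additive Kˣ) {β : A} {Y : FreeAlgebra K I}
    (hY : Y ∈ wtSpace K α β) : scal α θ Y ∈ wtSpace K α β := by
  have : wtSpace K α β ≤ (wtSpace K α β).comap (scal α θ) := by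
    refine Submodule.span_le.2 ?_
    rintro _ ⟨l, rfl, rfl⟩
    change scal α θ (word K l) ∈ wtSpace K α (wt α l)
    rw [scal_word]
    exact Submodule.smul_mem _ _ (word_mem_wtSpace α l)
  exact this hY

theorem constTerm_of_mem_wtSpace {β : A} (hβ : β ≠ 0) {Y : FreeAlgebra K I}
    (hY : Y ∈ wtSpace K α β) : constTerm Y = 0 := by
  have : wtSpace K α β ≤ LinearMap.ker (constTerm (K := K) (I := I)).toLinearMap := by
    refine Submodule.span_le.2 ?_
    rintro _ ⟨l, rfl, rfl⟩
    cases l with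
    | nil => exact absurd rfl hβ
    | cons i l => simp
  exact this hY

theorem mem_wtSpace_of_height_eq_zero {β : A} (hβ : height α β = 0) {Y : FreeAlgebra K I}
    (hY : Y ∈ wtSpace K α β) : Y = constTerm Y • 1 := by
  have : wtSpace K α β ≤ LinearMap.eqLocus LinearMap.id
      ((constTerm (K := K) (I := I)).toLinearMap.smulRight 1) := by
    refine Submodule.span_le.2 ?_
    rintro _ ⟨l, rfl, rfl⟩
    rw [height_wt, Nat.cast_eq_zero, List.length_eq_zero_iff] at hβ
    subst hβ
    simp
  exact this hY

theorem eq_zero_of_height_neg {β : A} (hβ : height α β < 0) {Y : FreeAlgebra K I}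
    (hY : Y ∈ wtSpace K α β) : Y = 0 := by
  have : wtSpace K α β ≤ ⊥ := by
    refine Submodule.span_le.2 ?_
    rintro _ ⟨l, rfl, rfl⟩
    rw [height_wt] at hβ
    omega
  exact this hY

variable [DecidableEq I]

theorem skewDer_mem_wtSpace (θ : A →+ Additive Kˣ) (i : I) {β : A} {Y : FreeAlgebra K I}
    (hY : Y ∈ wtSpace K α β) : skewDer α θ i Y ∈ wtSpace K α (β - α i) := by
  have : wtSpace K α β ≤ (wtSpace K α (β - α i)).comap (skewDer α θ i) := by
    refine Submodule.span_le.2 ?_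
    rintro _ ⟨l, rfl, rfl⟩
    change skewDer α θ i (word K l) ∈ wtSpace K α (wt α l - α i)
    clear hY
    induction l with
    | nil => rw [word_nil, skewDer_one]; exact zero_mem _
    | cons j l ih =>
      rw [word_cons, skewDer_ι_mul, wt_cons]
      refine add_mem ?_ ?_
      · split_ifs with h
        · rw [h, add_sub_cancel_left]
          exact scal_mem_wtSpace α θ (word_mem_wtSpace α l)
        · exact zero_mem _
      · rw [add_sub_assoc]
        exact ι_mul_mem_wtSpace α j ih
  exact this hY

theorem dualOp_word_mem_wtSpace (l m : List I) :
    dualOp χ α (word K l) (word K m) ∈ wtSpace K α (wt α m - wt α l) := by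
  induction l with
  | nil => simpa using word_mem_wtSpace α m
  | cons i l ih =>
    rw [word_cons, map_mul, Module.End.mul_apply, dualOp_ι, wt_cons, add_comm, ← sub_sub]
    exact skewDer_mem_wtSpace α _ i ih

theorem constTerm_dualOp_of_wt_ne {l m : List I} (h : wt α l ≠ wt α m) :
    constTerm (dualOp χ α (word K l) (word K m)) = 0 :=
  constTerm_of_mem_wtSpace α (sub_ne_zero.2 h.symm) (dualOp_word_mem_wtSpace χ α l m)

/-- The weight spaces of `U⁻`, where `F_i` has weight `-α_i`. -/
def NegQuot.wtSpace (β : A) : Submodule K (NegQuot χ α) :=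
  (GenQuantumGroup.wtSpace K α (-β)).map (NegQuot.mk χ α)

/-- Homogeneous operators of degree `β`. -/
def homog (β : A) : Submodule K (TorusEnd χ α) where
  carrier := {r | ∀ g γ, ∀ n ∈ NegQuot.wtSpace χ α γ, r.coeff g n ∈ NegQuot.wtSpace χ α (β + γ)}
  add_mem' hr hs g γ n hn := add_mem (hr g γ n hn) (hs g γ n hn)
  zero_mem' _ _ _ _ := zero_mem _
  smul_mem' c _ hr g γ n hn := Submodule.smul_mem _ c (hr g γ n hn)

theorem single_mem_homog {β : A} (g : A × A) {f : Module.End K (NegQuot χ α)}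
    (hf : ∀ γ, ∀ n ∈ NegQuot.wtSpace χ α γ, f n ∈ NegQuot.wtSpace χ α (β + γ)) :
    single g f ∈ homog χ α β := by
  classical
  intro h γ n hn
  rw [AddMonoidAlgebra.coeff_single, Finsupp.single_apply]
  split_ifs
  · exact hf γ n hn
  · exact zero_mem _

theorem mul_mem_homog {β β' : A} {r s : TorusEnd χ α} (hr : r ∈ homog χ α β)
    (hs : s ∈ homog χ α β') : r * s ∈ homog χ α (β + β') := by
  intro g γ n hn
  rw [AddMonoidAlgebra.coeff_mul_apply_left, Finsupp.sum, LinearMap.sum_apply]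
  refine Submodule.sum_mem _ fun h _ => ?_
  rw [Module.End.mul_apply, add_assoc]
  exact hr h _ _ (hs _ γ n hn)

theorem one_mem_homog : 1 ∈ homog χ α 0 :=
  single_mem_homog χ α 0 fun γ n hn => by rwa [zero_add]

theorem genAct_mem_homog (x : Gen A I) : genAct χ α x ∈ homog χ α (x.deg α) := by
  have hder : ∀ (θ : A →+ Additive Kˣ) (i : I) (γ : A) (Y : FreeAlgebra K I),
      Y ∈ wtSpace K α (-γ) → skewDer α θ i Y ∈ wtSpace K α (-(α i + γ)) := by
    intro θ i γ Y hY
    rw [neg_add_rev, ← sub_eq_add_neg]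
    exact skewDer_mem_wtSpace α θ i hY
  cases x with
  | K a =>
    refine single_mem_homog χ α _ ?_
    rintro γ _ ⟨Y, hY, rfl⟩
    rw [Gen.deg, zero_add]
    exact ⟨_, scal_mem_wtSpace α _ hY, rfl⟩
  | L a =>
    refine single_mem_homog χ α _ ?_
    rintro γ _ ⟨Y, hY, rfl⟩
    rw [Gen.deg, zero_add]
    exact ⟨_, scal_mem_wtSpace α _ hY, rfl⟩
  | F i =>
    refine single_mem_homog χ α _ ?_
    rintro γ _ ⟨Y, hY, rfl⟩
    refine ⟨_, ?_, rfl⟩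
    rw [Gen.deg, neg_add_rev, neg_neg, add_comm]
    exact ι_mul_mem_wtSpace α i hY
  | E i =>
    refine sub_mem (single_mem_homog χ α _ ?_) (single_mem_homog χ α _ ?_)
    · rintro γ _ ⟨Y, hY, rfl⟩
      exact ⟨_, hder _ i γ Y hY, rfl⟩
    · rintro γ _ ⟨Y, hY, rfl⟩
      exact ⟨_, hder _ i γ Y hY, rfl⟩

theorem rep_mem_homog {β : A} {u : U χ α} (hu : u ∈ gradedPiece χ α β) :
    rep χ α u ∈ homog χ α β := by
  have : gradedPiece χ α β ≤ (homog χ α β).comap (rep χ α).toLinearMap := by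
    refine Submodule.span_le.2 ?_
    rintro _ ⟨l, rfl, rfl⟩
    change rep χ α _ ∈ homog χ α _
    clear hu
    induction l with
    | nil => simpa using one_mem_homog χ α
    | cons x l ih =>
      rw [List.map_cons (f := U.gen χ α), List.prod_cons, List.map_cons, List.sum_cons, map_mul,
        rep_gen]
      exact mul_mem_homog χ α (genAct_mem_homog χ α x) ih
  exact this hu

theorem pos_word (l : List I) :
    U.pos χ α (word K l) = ((l.map Gen.E).map (U.gen χ α)).prod := by
  induction l with
  | nil => simp
  | cons i l ih => simp [ih]

theorem neg_word (l : List I) :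
    U.neg χ α (word K l) = ((l.map Gen.F).map (U.gen χ α)).prod := by
  induction l with
  | nil => simp
  | cons i l ih => simp [ih]

theorem pos_word_mem (l : List I) : U.pos χ α (word K l) ∈ gradedPiece χ α (wt α l) := by
  refine Submodule.subset_span ⟨l.map Gen.E, ?_, (pos_word χ α l).symm⟩
  induction l with
  | nil => simp
  | cons i l ih => simpa [Gen.deg] using ih

theorem neg_word_mem (l : List I) : U.neg χ α (word K l) ∈ gradedPiece χ α (-wt α l) := by
  refine Submodule.subset_span ⟨l.map Gen.F, ?_, (neg_word χ α l).symm⟩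
  induction l with
  | nil => simp
  | cons i l ih =>
    rw [List.map_cons, List.map_cons, List.sum_cons, ih, wt_cons, neg_add]
    rfl

/-! ### Faithfulness of the universal Verma module -/

/-- The coefficient at `g` of the vector `X F_m` of the universal Verma module. -/
def act (X : FreeAlgebra K I) (g : A × A) (m : List I) : NegQuot χ α :=
  (rep χ α (U.pos χ α X)).coeff g (NegQuot.mk χ α (word K m))

theorem act_add (X X' : FreeAlgebra K I) (g : A × A) (m : List I) :
    act χ α (X + X') g m = act χ α X g m + act χ α X' g m := by
  simp only [act, map_add]
  rfl

theorem act_smul (c : K) (X : FreeAlgebra K I) (g : A × A) (m : List I) :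
    act χ α (c • X) g m = c • act χ α X g m := by
  simp only [act, map_smul]
  rfl

theorem act_word_mem (l m : List I) (g : A × A) :
    ∃ Y ∈ wtSpace K α (wt α m - wt α l), NegQuot.mk χ α Y = act χ α (word K l) g m := by
  have h := rep_mem_homog χ α (pos_word_mem χ α l) g (-wt α m) (NegQuot.mk χ α (word K m))
    ⟨_, by rw [neg_neg]; exact word_mem_wtSpace α m, rfl⟩
  obtain ⟨Y, hY, e⟩ := h
  rw [show -(wt α l + -wt α m) = wt α m - wt α l by abel] at hY
  exact ⟨Y, hY, e⟩

/-- The result has weight of height zero, and only scalars in `U⁻` have such a weight. In the next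
lemma the height is negative and nothing is left. -/
theorem act_word_of_length_eq {l m : List I} (h : l.length = m.length) (g : A × A) :
    act χ α (word K l) g m =
      NegQuot.const χ α (act χ α (word K l) g m) • NegQuot.mk χ α 1 := by
  obtain ⟨Y, hY, e⟩ := act_word_mem χ α l m g
  rw [← e, NegQuot.const_mk, ← map_smul, ← mem_wtSpace_of_height_eq_zero α _ hY]
  simp [h]

theorem act_word_of_length_lt {l m : List I} (h : m.length < l.length) (g : A × A) :
    act χ α (word K l) g m = 0 := by
  obtain ⟨Y, hY, e⟩ := act_word_mem χ α l m g
  rw [← e, eq_zero_of_height_neg α _ hY, map_zero]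
  simp [h]

theorem const_act_word_of_wt_ne {l m : List I} (h : wt α l ≠ wt α m) (g : A × A) :
    NegQuot.const χ α (act χ α (word K l) g m) = 0 := by
  obtain ⟨Y, hY, e⟩ := act_word_mem χ α l m g
  rw [← e, NegQuot.const_mk, constTerm_of_mem_wtSpace α (sub_ne_zero.2 h.symm) hY]

open Classical in
-- Each letter contributes either `L_{α_i}`, raising the height of the second exponent by one, or
-- `K_{α_i}`, not raising it. Height at least the number of letters is reached only by choosing `L`
-- every time, and the product of the corresponding derivations is `dualOp`.
theorem coeff_rep_word_of_le (l : List I) : ∀ (g : A × A), (l.length : ℤ) ≤ height α g.2 →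
    ∀ Y, (rep χ α (U.pos χ α (word K l))).coeff g (NegQuot.mk χ α Y) =
      if g = (0, wt α l) then NegQuot.mk χ α (dualOp χ α (word K l) Y) else 0 := by
  induction l with
  | nil =>
    intro g _ Y
    rw [word_nil, map_one (U.pos χ α), map_one (rep χ α), AddMonoidAlgebra.one_def,
      AddMonoidAlgebra.coeff_single, Finsupp.single_apply, map_one (dualOp χ α), wt_nil,
      Prod.mk_zero_zero]
    simp only [eq_comm (a := g)]
    split_ifs <;> simp
  | cons i l ih =>
    intro g hg Y
    rw [List.length_cons, Nat.cast_succ] at hg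
    rw [word_cons, map_mul (U.pos χ α), map_mul (rep χ α), U.pos_ι, rep_gen, genAct, sub_mul,
      AddMonoidAlgebra.coeff_sub, Finsupp.sub_apply, AddMonoidAlgebra.coeff_single_mul_apply,
      AddMonoidAlgebra.coeff_single_mul_apply, LinearMap.sub_apply, Module.End.mul_apply,
      Module.End.mul_apply, ih, ih]
    -- If the first letter contributes `K`, the remaining `l.length` letters would have to reach
    -- `L`-height at least `l.length + 1`.
    · have h1 : -(α i, (0 : A)) + g ≠ (0, wt α l) := by
        intro e
        have := congrArg (fun x => height α x.2) e
        simp at this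
        omega
      have h2 : -((0 : A), α i) + g = (0, wt α l) ↔ g = (0, wt α (i :: l)) := by
        rw [neg_add_eq_iff_eq_add, wt_cons, Prod.mk_add_mk, zero_add]
      rw [if_neg h1, map_zero, sub_zero]
      simp only [h2]
      split_ifs <;> simp
    · simp; omega
    · simp; omega

open Classical in
-- The bound involves `m` rather than the lengths of words in `X`: words of weight other than that
-- of `m` contribute zero to both sides, so only words as long as `m` matter. The top coefficient is
-- the Drinfeld pairing of `X` with `F_m`.
theorem const_act_of_le (X : FreeAlgebra K I) (g : A × A) (m : List I)
    (hg : (m.length : ℤ) ≤ height α g.2) :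
    NegQuot.const χ α (act χ α X g m) =
      if g = (0, wt α m) then constTerm (dualOp χ α X (word K m)) else 0 := by
  induction X using word_induction with
  | hword l =>
    by_cases h : wt α l = wt α m
    · rw [act, coeff_rep_word_of_le χ α l g (by rwa [length_eq_of_wt_eq α h]), h]
      split_ifs <;> simp
    · rw [const_act_word_of_wt_ne χ α h, constTerm_dualOp_of_wt_ne χ α h, ite_self]
  | hadd X X' h h' =>
    rw [act_add, map_add, h, h']
    split_ifs <;> simp
  | hsmul c X h =>
    rw [act_smul, map_smul, h]
    split_ifs <;> simp

/-- The part of `X` spanned by words of length less than `n`. -/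
def truncate (n : ℕ) : FreeAlgebra K I →ₗ[K] FreeAlgebra K I :=
  ofWords fun l => if l.length < n then word K l else 0

/-- Words of different lengths are orthogonal, so the truncation pairs like `X` with short words and
trivially with long ones. -/
theorem truncate_mem_radPos {n : ℕ} {X : FreeAlgebra K I}
    (h : ∀ m : List I, m.length < n → constTerm (dualOp χ α X (word K m)) = 0) :
    truncate n X ∈ radPos χ α := by
  rw [mem_radPos_iff_word]
  intro m
  have key : ∀ X : FreeAlgebra K I, constTerm (dualOp χ α (truncate n X) (word K m)) =
      if m.length < n then constTerm (dualOp χ α X (word K m)) else 0 := by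
    intro X
    induction X using word_induction with
    | hword l =>
      rw [truncate, ofWords_word]
      by_cases h : l.length = m.length
      · rw [h]; split_ifs <;> simp
      · have h0 := constTerm_dualOp_of_wt_ne (K := K) χ α fun e => h (length_eq_of_wt_eq α e)
        split_ifs <;> simp [h0]
    | hadd X X' h h' =>
      rw [map_add, map_add, LinearMap.add_apply, map_add, h, h', map_add, LinearMap.add_apply,
        map_add]
      split_ifs <;> simp
    | hsmul c X h =>
      rw [map_smul, map_smul, LinearMap.smul_apply, map_smul, h, map_smul, LinearMap.smul_apply,
        map_smul]
      split_ifs <;> simp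
  rw [key]
  split_ifs with hm
  · exact h m hm
  · rfl

theorem act_of_mem_radPos {X : FreeAlgebra K I} (hX : X ∈ radPos χ α) (g : A × A) (m : List I) :
    act χ α X g m = 0 := by
  rw [act, U.pos_eq_zero χ α hX, map_zero]
  rfl

theorem act_eq_act_sub_truncate {n : ℕ} {X : FreeAlgebra K I}
    (h : ∀ m : List I, m.length < n → constTerm (dualOp χ α X (word K m)) = 0)
    (g : A × A) (m : List I) : act χ α X g m = act χ α (X - truncate n X) g m := by
  have := act_add χ α (X - truncate n X) (truncate n X) g m
  rwa [sub_add_cancel, act_of_mem_radPos χ α (truncate_mem_radPos χ α h), add_zero] at this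

/-- The part of `X` shorter than `m` lies in the radical and acts by zero, the part longer than `m`
kills `F_m` by weight, and the part of equal length produces scalars. In `act_eq_zero` the
equal-length part is in the radical too. -/
theorem act_eq_const_smul {X : FreeAlgebra K I} (m : List I)
    (h : ∀ m' : List I, m'.length < m.length → constTerm (dualOp χ α X (word K m')) = 0)
    (g : A × A) : act χ α X g m = NegQuot.const χ α (act χ α X g m) • NegQuot.mk χ α 1 := by
  rw [act_eq_act_sub_truncate χ α h]
  clear h
  induction X using word_induction with
  | hword l =>
    rw [truncate, ofWords_word]
    rcases lt_trichotomy l.length m.length with h | h | h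
    · rw [if_pos h, sub_self]
      simp [act]
    · rw [if_neg h.not_lt, sub_zero]
      exact act_word_of_length_eq χ α h g
    · rw [if_neg h.not_gt, sub_zero, act_word_of_length_lt χ α h]
      simp
  | hadd X X' h h' =>
    rw [map_add, add_sub_add_comm, act_add, map_add, add_smul, ← h, ← h']
  | hsmul c X h =>
    rw [map_smul, ← smul_sub, act_smul, map_smul, smul_assoc, ← h]

theorem act_eq_zero {X : FreeAlgebra K I} (m : List I)
    (h : ∀ m' : List I, m'.length < m.length + 1 → constTerm (dualOp χ α X (word K m')) = 0)
    (g : A × A) : act χ α X g m = 0 := by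
  rw [act_eq_act_sub_truncate χ α h]
  clear h
  induction X using word_induction with
  | hword l =>
    rw [truncate, ofWords_word]
    split_ifs with h
    · simp [act]
    · rw [sub_zero]
      exact act_word_of_length_lt χ α (by omega) g
  | hadd X X' h h' => rw [map_add, add_sub_add_comm, act_add, h, h', add_zero]
  | hsmul c X h => rw [map_smul, ← smul_sub, act_smul, h, smul_zero]

/-! ### Triangular expansions along a basis of `U⁻` -/

theorem U.neg_eq_of_mk_eq {Y Y' : FreeAlgebra K I}
    (h : NegQuot.mk χ α Y = NegQuot.mk χ α Y') : U.neg χ α Y = U.neg χ α Y' := by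
  rw [← sub_eq_zero, ← map_sub, NegQuot.mk_eq_zero] at h
  have h' := U.neg_eq_zero χ α h
  rwa [map_sub, sub_eq_zero] at h'

/-- The map `U⁻ → U`. -/
def U.ofNegQuot : NegQuot χ α →ₗ[K] U χ α where
  toFun n := U.neg χ α (Function.surjInv (NegQuot.mk_surjective χ α) n)
  map_add' x y := by
    rw [← map_add]
    apply U.neg_eq_of_mk_eq
    simp only [map_add, Function.surjInv_eq]
  map_smul' c x := by
    rw [RingHom.id_apply, ← map_smul]
    apply U.neg_eq_of_mk_eq
    simp only [map_smul, Function.surjInv_eq]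

theorem U.ofNegQuot_mk (Y : FreeAlgebra K I) :
    U.ofNegQuot χ α (NegQuot.mk χ α Y) = U.neg χ α Y :=
  U.neg_eq_of_mk_eq χ α (Function.surjInv_eq _ _)

theorem rep_neg (Y : FreeAlgebra K I) : ∃ f, rep χ α (U.neg χ α Y) = single 0 f ∧
    ∀ Z, f (NegQuot.mk χ α Z) = NegQuot.mk χ α (Y * Z) := by
  obtain ⟨f, hf, hf'⟩ := repTilde_ofNeg χ α Y
  exact ⟨f, by rw [U.neg, AlgHom.comp_apply, rep_ofTilde, hf], hf'⟩

/-- When `X` sends `F_m` to a multiple of the vector `1`, the torus only shifts the exponent, since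
it scales `1` trivially, and the `U⁻`-factor is read off undisturbed. Linear independence in `U⁻`
then becomes available. -/
theorem coeff_rep_triangular (n : NegQuot χ α) (h g : A × A) (X : FreeAlgebra K I) (m : List I)
    {c : K} (hc : act χ α X (g - h) m = c • NegQuot.mk χ α 1) :
    (rep χ α (U.ofNegQuot χ α n * (U.torus χ α h * U.pos χ α X))).coeff g
      (NegQuot.mk χ α (word K m)) = c • n := by
  obtain ⟨Y, rfl⟩ := NegQuot.mk_surjective χ α n
  obtain ⟨f, hf, hf'⟩ := rep_neg χ α Y
  rw [act, sub_eq_neg_add] at hc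
  rw [U.ofNegQuot_mk, map_mul, map_mul, hf, rep_torus, AddMonoidAlgebra.coeff_single_mul_apply,
    AddMonoidAlgebra.coeff_single_mul_apply, neg_zero, zero_add, Module.End.mul_apply,
    Module.End.mul_apply, hc, map_smul, map_smul, NegQuot.scal_mk, scal_one, hf', mul_one]

variable {ι : Type*} (b : Module.Basis ι K (NegQuot χ α))

/-- Sums of triangular products along a basis of `U⁻`. -/
def triangularSum : (ι × (A × A) →₀ FreeAlgebra K I) →ₗ[K] U χ α :=
  Finsupp.lsum K fun p => LinearMap.mulLeft K (U.ofNegQuot χ α (b p.1)) ∘ₗ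
    LinearMap.mulLeft K (U.torus χ α p.2) ∘ₗ (U.pos χ α).toLinearMap

theorem triangularSum_apply (t : ι × (A × A) →₀ FreeAlgebra K I) :
    triangularSum χ α b t = ∑ p ∈ t.support,
      U.ofNegQuot χ α (b p.1) * (U.torus χ α p.2 * U.pos χ α (t p)) := rfl

theorem triangularSum_surjective : Function.Surjective (triangularSum χ α b) := by
  rw [← LinearMap.range_eq_top, eq_top_iff, ← U.triangular_eq_top, U.triangular,
    Submodule.span_le]
  rintro _ ⟨⟨l, g, m⟩, rfl⟩
  have key : ∀ n : NegQuot χ α, U.ofNegQuot χ α n * (U.torus χ α g * U.pos χ α (word K m)) ∈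
      LinearMap.range (triangularSum χ α b) := by
    intro n
    have hn : n ∈ Submodule.span K (Set.range b) := by rw [b.span_eq]; exact Submodule.mem_top
    induction hn using Submodule.span_induction with
    | mem n hn =>
      obtain ⟨i, rfl⟩ := hn
      refine ⟨Finsupp.single (i, g) (word K m), ?_⟩
      rw [triangularSum, Finsupp.lsum_single]
      rfl
    | zero => rw [map_zero, zero_mul]; exact zero_mem _
    | add x y _ _ hx hy => rw [map_add, add_mul]; exact add_mem hx hy
    | smul c x _ hx => rw [map_smul, smul_mul_assoc]; exact Submodule.smul_mem _ c hx
  have h := key (NegQuot.mk χ α (word K l))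
  rwa [U.ofNegQuot_mk] at h

/-- Strong induction on the length of `m`. Once all coefficients pair to zero with shorter words,
they send `F_m` to scalars, so one basis coordinate isolates the terms with a given `U⁻`-factor.
Among these an extremal torus exponent isolates a single term, whose contribution is the pairing. -/
theorem constTerm_dualOp_of_rep_eq_zero (t : ι × (A × A) →₀ FreeAlgebra K I)
    (ht : rep χ α (triangularSum χ α b t) = 0) (n : ℕ) : ∀ p (m : List I), m.length = n →
      constTerm (dualOp χ α (t p) (word K m)) = 0 := by
  classical
  induction n using Nat.strong_induction_on with
  | _ n ih =>
  by_contra! hcon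
  obtain ⟨p0, m0, hm0, hne0⟩ := hcon
  let S := t.support.filter fun p => p.1 = p0.1 ∧
    ∃ m : List I, m.length = n ∧ constTerm (dualOp χ α (t p) (word K m)) ≠ 0
  have hS : ∀ p, p ∈ S ↔ p.1 = p0.1 ∧
      ∃ m : List I, m.length = n ∧ constTerm (dualOp χ α (t p) (word K m)) ≠ 0 := by
    intro p
    simp only [S, Finset.mem_filter, Finsupp.mem_support_iff, and_iff_right_iff_imp]
    rintro ⟨-, m, -, hm⟩ h0
    simp [h0] at hm
  -- Among the offending indices with the same basis vector, take one whose `L`-exponent has maximal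
  -- height.
  obtain ⟨p1, hp1, hmax⟩ := S.exists_max_image (fun p => height α p.2.2)
    ⟨p0, (hS p0).2 ⟨rfl, m0, hm0, hne0⟩⟩
  obtain ⟨hp10, m, hm, hne⟩ := (hS p1).1 hp1
  apply hne
  -- This is the exponent of the top `L`-term of the `p1` summand. By maximality, any `p ∈ S` is
  -- tested at an exponent `G - p.2` of `L`-height at least `m.length`, where `const_act_of_le`
  -- allows a nonzero value only if `p.2 = p1.2`.
  let G : A × A := p1.2 + (0, wt α m)
  have hc : ∀ p g, act χ α (t p) g m =
      NegQuot.const χ α (act χ α (t p) g m) • NegQuot.mk χ α 1 := fun p g =>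
    act_eq_const_smul χ α m (fun m' h => ih _ (hm ▸ h) p m' rfl) g
  have hsum : ∑ p ∈ t.support, NegQuot.const χ α (act χ α (t p) (G - p.2) m) • b p.1 = 0 := by
    have h := congr(($ht).coeff G (NegQuot.mk χ α (word K m)))
    rw [triangularSum_apply, map_sum, AddMonoidAlgebra.coeff_sum, Finsupp.finsetSum_apply,
      LinearMap.sum_apply] at h
    refine (Finset.sum_congr rfl fun p _ => ?_).trans h
    exact (coeff_rep_triangular χ α (b p.1) p.2 G (t p) m (hc p _)).symm
  have hcoord := congr(b.coord p0.1 $hsum)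
  rw [map_sum, map_zero, Finset.sum_eq_single p1] at hcoord
  · rw [map_smul, hp10, b.coord_apply, b.repr_self, Finsupp.single_eq_same, smul_eq_mul, mul_one,
      add_sub_cancel_left, const_act_of_le χ α _ _ _ (by simp), if_pos rfl] at hcoord
    exact hcoord
  · intro p _ hp
    by_cases hpi : p.1 = p0.1
    · have h0 : NegQuot.const χ α (act χ α (t p) (G - p.2) m) = 0 := by
        by_cases hpS : p ∈ S
        · have hle := hmax p hpS
          rw [const_act_of_le, if_neg]
          · intro e
            rw [sub_eq_iff_eq_add', add_left_inj] at e
            exact hp (Prod.ext (hpi.trans hp10.symm) e.symm)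
          · simp only [G, Prod.snd_sub, Prod.snd_add, map_sub, map_add, height_wt]
            omega
        -- Outside `S`, the coefficient pairs to zero with all words of length at most `n`, so it
        -- kills `F_m` altogether.
        · rw [act_eq_zero χ α m, map_zero]
          intro m' hm'
          rcases Nat.lt_succ_iff_lt_or_eq.1 hm' with h | h
          · exact ih _ (hm ▸ h) p m' rfl
          · by_contra h'
            exact hpS ((hS p).2 ⟨hpi, m', h.trans hm, h'⟩)
      rw [h0, zero_smul, map_zero]
    · rw [map_smul, b.coord_apply, b.repr_self, Finsupp.single_eq_of_ne (Ne.symm hpi), smul_zero]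
  · intro h
    rw [Finsupp.notMem_support_iff.1 h]
    simp [act]

/-- In a triangular expansion of an element acting by zero, every `Ũ⁺`-coefficient pairs to zero
with all words, hence lies in the radical and is zero in `U`. Linear independence of the triangular
products is never needed beforehand. -/
theorem rep_injective : Function.Injective (rep χ α) := by
  rw [injective_iff_map_eq_zero]
  intro u hu
  obtain ⟨t, rfl⟩ := triangularSum_surjective χ α (Module.Basis.ofVectorSpace K (NegQuot χ α)) u
  rw [triangularSum_apply]
  refine Finset.sum_eq_zero fun p _ => ?_
  rw [U.pos_eq_zero χ α, mul_zero, mul_zero]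
  rw [mem_radPos_iff_word]
  exact fun m => constTerm_dualOp_of_rep_eq_zero χ α _ t hu _ p m rfl

/-! ### The Harish-Chandra map -/

theorem eq_zero_of_shapovalovCoeff_eq_zero {ϖ : A →+ Additive Kˣ} {Z : U χ α}
    (hZ : Z ∈ skewCenter χ α ϖ) (h0 : shapovalovCoeff χ α Z = 0) : Z = 0 := by
  obtain ⟨hZ0, hZc⟩ := hZ
  -- Because `Z` has degree zero, each coefficient of `Z · 1` has weight zero and so equals its own
  -- constant term, which is a Shapovalov coefficient.
  have hvac : ∀ g, (rep χ α Z).coeff g (NegQuot.mk χ α 1) = 0 := by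
    intro g
    obtain ⟨Y, hY, e⟩ := rep_mem_homog χ α hZ0 g 0 (NegQuot.mk χ α 1)
      ⟨1, by rw [neg_zero]; exact word_mem_wtSpace α [], rfl⟩
    have hg : NegQuot.const χ α ((rep χ α Z).coeff g (NegQuot.mk χ α 1)) = 0 :=
      congr($h0 g)
    rw [← e, NegQuot.const_mk] at hg
    rw [← e, mem_wtSpace_of_height_eq_zero α (by simp) hY, hg, zero_smul, map_zero]
  apply rep_injective χ α
  rw [map_zero, ← AddMonoidAlgebra.coeff_eq_zero]
  ext1 g
  refine NegQuot.hom_ext χ α fun l => ?_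
  obtain ⟨f, hf, hf'⟩ := rep_neg χ α (word K l)
  -- Skew commutation with `F_l`, applied to the vector `1`: the left side is `Z` acting on `F_l`,
  -- and the right side is a multiple of `F_l` times `Z · 1`, which vanishes.
  have h := congr((rep χ α $(hZc _ _ (neg_word_mem χ α l))).coeff g (NegQuot.mk χ α 1))
  rw [map_smul, map_mul, map_mul, hf, AddMonoidAlgebra.coeff_smul_apply, LinearMap.smul_apply,
    AddMonoidAlgebra.coeff_mul_single_apply, AddMonoidAlgebra.coeff_single_mul_apply,
    Module.End.mul_apply, Module.End.mul_apply, hvac, map_zero, smul_zero, hf', mul_one, neg_zero,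
    add_zero] at h
  exact h

end Faithful

end GenQuantumGroup

end

theorem mainTheorem7 {K : Type*} {A : Type*} {I : Type*} [Field K] [IsAlgClosed K]
    [AddCommGroup A] [Finite I] [DecidableEq I] (α : Module.Basis I ℤ A)
    (χ : A →+ A →+ Additive Kˣ) (ϖ : A →+ Additive Kˣ) :
    (∃! Sh : GenQuantumGroup.U χ α →ₗ[K] GenQuantumGroup.U0 χ α,
      GenQuantumGroup.IsShapovalovMap χ α Sh) ∧
    ∀ Sh : GenQuantumGroup.U χ α →ₗ[K] GenQuantumGroup.U0 χ α,
      GenQuantumGroup.IsShapovalovMap χ α Sh →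
        Function.Injective (Sh.domRestrict (GenQuantumGroup.skewCenter χ α ϖ)) := by
  have h := GenQuantumGroup.isShapovalovMap_shapovalov χ α
  refine ⟨⟨_, h, fun S hS => hS.unique χ α h⟩, fun S hS => ?_⟩
  obtain rfl := hS.unique χ α h
  intro Z Z' hZ
  replace hZ : GenQuantumGroup.shapovalov χ α (Z : GenQuantumGroup.U χ α) =
    GenQuantumGroup.shapovalov χ α (Z' : GenQuantumGroup.U χ α) := hZ
  have h0 : (Z : GenQuantumGroup.U χ α) + (-1 : K) • (Z' : GenQuantumGroup.U χ α) = 0 := by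
    refine GenQuantumGroup.eq_zero_of_shapovalovCoeff_eq_zero χ α
      (add_mem Z.2 (Submodule.smul_mem _ (-1) Z'.2)) ?_
    rw [map_add, map_smul, ← GenQuantumGroup.shapovalovCoeff_shapovalov, hZ,
      GenQuantumGroup.shapovalovCoeff_shapovalov, neg_one_smul, add_neg_cancel]
  refine Subtype.ext ?_
  have h1 : (-1 : K) • (Z' : GenQuantumGroup.U χ α) + Z' = 0 := by
    nth_rewrite 2 [← one_smul K (Z' : GenQuantumGroup.U χ α)]
    rw [← add_smul, neg_add_cancel, zero_smul]
  calc (Z : GenQuantumGroup.U χ α) = Z + ((-1 : K) • (Z' : GenQuantumGroup.U χ α) + Z') := by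
        rw [h1, add_zero]
    _ = Z' := by rw [← add_assoc, h0, zero_add]
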